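/- For a group $G$, let $\mathcal A_2(G)$ be the universal unital complex algebra with generators $a_{ij}(g)$ ($1\le i,j\le 2$, $g\in G$) and relations, for $1\le i,j,k\le 2$ and $g,h\in G$, $$a_{ij}(g)a_{ik}(h)=\delta_{jk}\,a_{ij}(gh),\qquad a_{ji}(g)a_{ki}(h)=\delta_{jk}\,a_{ji}(gh),\qquad \sum_{l=1}^{2} a_{il}(1)=1=\sum_{l=1}^{2} a_{li}(1),$$ with comultiplication $\Delta(a_{ij}(g))=\sum_{k=1}^{2} a_{ik}(g)\otimes a_{kj}(g)$ and counit $\varepsilon(a_{ij}(g))=\delta_{ij}$. The fusion semiring of $\mathcal A_2(G)$ is the set of isomorphism classes of its finite-dimensional corepresentations, with addition induced by the direct sum and multiplication induced by the tensor product. The fusion semiring of the compact group $O(2)$ of real orthogonal $2\times 2$ matrices is defined in the same way from its continuous finite-dimensional complex representations. Corollary 2.7. Let $G$ be a nontrivial group. Then the fusion semiring of $\mathcal A_2(G)$ is commutative (that is, its multiplication is commutative) if and only if $G\cong\mathbb Z/2\mathbb Z$. In this case the fusion semiring of $\mathcal A_2(G)$ is isomorphic, as a semiring, to the fusion semiring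 of $O(2)$. -/

import Mathlib

open scoped TensorProduct Kronecker

noncomputable section

namespace Fusion

/-! ### Matrices over a complex algebra: equivalence, direct sum, tensor product -/

set_option linter.unusedSectionVars false

section Matrices

variable {A : Type*} [Semiring A] [Algebra ℂ A]
variable {ι κ μ ι' κ' : Type*} [Fintype ι] [Fintype κ] [Fintype μ] [Fintype ι'] [Fintype κ']
variable [DecidableEq ι] [DecidableEq κ] [DecidableEq μ] [DecidableEq ι'] [DecidableEq κ']

/-- A complex matrix, regarded as a matrix with scalar entries in `A`. -/
def scal (A : Type*) [Semiring A] [Algebra ℂ A] {ι κ : Type*} (T : Matrix ι κ ℂ) :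
    Matrix ι κ A :=
  T.map (algebraMap ℂ A)

/-- Two square matrices over `A` are equivalent if they are intertwined by an invertible complex
matrix `T` (with inverse `S`), that is `T u = v T`. -/
def MatEquiv (u : Matrix ι ι A) (v : Matrix κ κ A) : Prop :=
  ∃ (T : Matrix κ ι ℂ) (S : Matrix ι κ ℂ), T * S = 1 ∧ S * T = 1 ∧ scal A T * u = v * scal A T

lemma scal_mul (T : Matrix ι κ ℂ) (S : Matrix κ μ ℂ) :
    scal A (T * S) = scal A T * scal A S :=
  Matrix.map_mul

lemma scal_one : scal A (1 : Matrix ι ι ℂ) = 1 :=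
  Matrix.map_one _ (map_zero _) (map_one _)

lemma MatEquiv.refl (u : Matrix ι ι A) : MatEquiv u u :=
  ⟨1, 1, by simp, by simp, by simp [scal_one]⟩

lemma MatEquiv.symm {u : Matrix ι ι A} {v : Matrix κ κ A} (h : MatEquiv u v) :
    MatEquiv v u := by
  obtain ⟨T, S, h1, h2, h3⟩ := h
  refine ⟨S, T, h2, h1, ?_⟩
  calc scal A S * v = scal A S * (v * scal A T) * scal A S := by
        rw [Matrix.mul_assoc, Matrix.mul_assoc, ← scal_mul, h1, scal_one, Matrix.mul_one]
    _ = u * scal A S := by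
        rw [← h3, ← Matrix.mul_assoc, ← scal_mul, h2, scal_one, Matrix.one_mul]

lemma MatEquiv.trans {u : Matrix ι ι A} {v : Matrix κ κ A} {w : Matrix μ μ A}
    (h : MatEquiv u v) (h' : MatEquiv v w) : MatEquiv u w := by
  obtain ⟨T, S, h1, h2, h3⟩ := h
  obtain ⟨T', S', h1', h2', h3'⟩ := h'
  refine ⟨T' * T, S * S', ?_, ?_, ?_⟩
  · rw [Matrix.mul_assoc, ← Matrix.mul_assoc T, h1, Matrix.one_mul, h1']
  · rw [Matrix.mul_assoc, ← Matrix.mul_assoc S', h2', Matrix.one_mul, h2]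
  · rw [scal_mul, Matrix.mul_assoc, h3, ← Matrix.mul_assoc, h3', Matrix.mul_assoc]

lemma MatEquiv.of_equiv {u : Matrix ι ι A} {v : Matrix κ κ A} (e : ι ≃ κ)
    (h : ∀ i j, u i j = v (e i) (e j)) : MatEquiv u v := by
  refine ⟨Matrix.of fun a i => if a = e i then 1 else 0,
    Matrix.of fun i a => if a = e i then 1 else 0, ?_, ?_, ?_⟩
  · ext a b
    obtain ⟨i, rfl⟩ := e.surjective a
    obtain ⟨j, rfl⟩ := e.surjective b
    simp [Matrix.mul_apply, Matrix.one_apply, eq_comm (a := j)]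
  · ext i j
    simp [Matrix.mul_apply, Matrix.one_apply, eq_comm (a := i)]
  · ext a j
    obtain ⟨i, rfl⟩ := e.surjective a
    simp [scal, Matrix.mul_apply, h, apply_ite (algebraMap ℂ A)]

/-- The direct sum of two square matrices: the block diagonal matrix. -/
def dsum (u : Matrix ι ι A) (v : Matrix κ κ A) : Matrix (ι ⊕ κ) (ι ⊕ κ) A :=
  Matrix.fromBlocks u 0 0 v

/-- The tensor product of two square matrices, with entries
`(u ⊗ v) (i, k) (j, l) = u i j * v k l`. -/
def tens (u : Matrix ι ι A) (v : Matrix κ κ A) : Matrix (ι × κ) (ι × κ) A :=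
  fun p q => u p.1 q.1 * v p.2 q.2

lemma MatEquiv.dsum {u : Matrix ι ι A} {u' : Matrix ι' ι' A} {v : Matrix κ κ A}
    {v' : Matrix κ' κ' A} (h : MatEquiv u u') (h' : MatEquiv v v') :
    MatEquiv (dsum u v) (dsum u' v') := by
  obtain ⟨T, S, h1, h2, h3⟩ := h
  obtain ⟨T', S', h1', h2', h3'⟩ := h'
  refine ⟨Matrix.fromBlocks T 0 0 T', Matrix.fromBlocks S 0 0 S', ?_, ?_, ?_⟩
  · simp [Matrix.fromBlocks_multiply, h1, h1']
  · simp [Matrix.fromBlocks_multiply, h2, h2']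
  · have e : scal A (Matrix.fromBlocks T 0 0 T') =
        Matrix.fromBlocks (scal A T) 0 0 (scal A T') := by
      simp [scal, Matrix.fromBlocks_map, Matrix.map_zero]
    simp [e, Fusion.dsum, Matrix.fromBlocks_multiply, h3, h3']

lemma MatEquiv.tens {u : Matrix ι ι A} {u' : Matrix ι' ι' A} {v : Matrix κ κ A}
    {v' : Matrix κ' κ' A} (h : MatEquiv u u') (h' : MatEquiv v v') :
    MatEquiv (tens u v) (tens u' v') := by
  obtain ⟨T, S, h1, h2, h3⟩ := h
  obtain ⟨T', S', h1', h2', h3'⟩ := h'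
  refine ⟨T ⊗ₖ T', S ⊗ₖ S', ?_, ?_, ?_⟩
  · rw [← Matrix.mul_kronecker_mul, h1, h1', Matrix.one_kronecker_one]
  · rw [← Matrix.mul_kronecker_mul, h2, h2', Matrix.one_kronecker_one]
  · ext ⟨a, b⟩ ⟨j, l⟩
    have e3 := congrFun (congrFun h3 a) j
    have e3' := congrFun (congrFun h3' b) l
    simp only [scal, Matrix.mul_apply, Matrix.map_apply] at e3 e3'
    have L : (scal A (T ⊗ₖ T') * Fusion.tens u v) (a, b) (j, l) =
        (∑ i, algebraMap ℂ A (T a i) * u i j) * ∑ k, algebraMap ℂ A (T' b k) * v k l := by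
      simp only [scal, Matrix.mul_apply, Fintype.sum_prod_type, Finset.sum_mul_sum, Fusion.tens,
        Matrix.map_apply, Matrix.kroneckerMap_apply, map_mul]
      refine Finset.sum_congr rfl fun i _ => Finset.sum_congr rfl fun k _ => ?_
      rw [mul_assoc, mul_assoc, ← mul_assoc (algebraMap ℂ A (T' b k)),
        Algebra.commutes (T' b k) (u i j), mul_assoc]
    have R : (Fusion.tens u' v' * scal A (T ⊗ₖ T')) (a, b) (j, l) =
        (∑ i, u' a i * algebraMap ℂ A (T i j)) * ∑ k, v' b k * algebraMap ℂ A (T' k l) := by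
      simp only [scal, Matrix.mul_apply, Fintype.sum_prod_type, Finset.sum_mul_sum, Fusion.tens,
        Matrix.map_apply, Matrix.kroneckerMap_apply, map_mul]
      refine Finset.sum_congr rfl fun i _ => Finset.sum_congr rfl fun k _ => ?_
      rw [mul_assoc, mul_assoc, ← mul_assoc (v' b k), ← Algebra.commutes (T i j) (v' b k),
        mul_assoc]
    rw [L, R, e3, e3']

end Matrices

/-! ### The semiring of equivalence classes -/

/-- A notion of finite-dimensional matrix representation with coefficients in a complex
algebra `A`: a class of square matrices over `A` that contains the zero-dimensional and the
trivial one, and is closed under direct sums and tensor products. It serves to build the semiring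
of equivalence classes once, for corepresentations of bialgebras and for representations of
topological groups. -/
structure RepClass (A : Type*) [Semiring A] [Algebra ℂ A] where
  IsRep : ∀ {n : ℕ}, Matrix (Fin n) (Fin n) A → Prop
  zero : IsRep (0 : Matrix (Fin 0) (Fin 0) A)
  one : IsRep (1 : Matrix (Fin 1) (Fin 1) A)
  add : ∀ {m n : ℕ} {u : Matrix (Fin m) (Fin m) A} {v : Matrix (Fin n) (Fin n) A},
    IsRep u → IsRep v → IsRep (Matrix.reindex finSumFinEquiv finSumFinEquiv (dsum u v))
  mul : ∀ {m n : ℕ} {u : Matrix (Fin m) (Fin m) A} {v : Matrix (Fin n) (Fin n) A},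
    IsRep u → IsRep v → IsRep (Matrix.reindex finProdFinEquiv finProdFinEquiv (tens u v))

namespace RepClass

variable {A : Type*} [Semiring A] [Algebra ℂ A] (C : RepClass A)

/-- The representations of the class `C`, in all dimensions. -/
structure Rep where
  dim : ℕ
  mat : Matrix (Fin dim) (Fin dim) A
  isRep : C.IsRep mat

instance setoid : Setoid C.Rep where
  r u v := MatEquiv u.mat v.mat
  iseqv := ⟨fun u => .refl u.mat, fun h => h.symm, fun h h' => h.trans h'⟩

/-- The set of equivalence classes of representations; its semiring structure is given by direct
sum and tensor product. -/
def Classes : Type _ := Quotient C.setoid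

variable {C}

/-- The direct sum of two representations. -/
def Rep.add (u v : C.Rep) : C.Rep := ⟨_, _, C.add u.isRep v.isRep⟩

/-- The tensor product of two representations. -/
def Rep.mul (u v : C.Rep) : C.Rep := ⟨_, _, C.mul u.isRep v.isRep⟩

lemma Rep.add_equiv (u v : C.Rep) : MatEquiv (u.add v).mat (dsum u.mat v.mat) :=
  .of_equiv finSumFinEquiv.symm fun _ _ => rfl

lemma Rep.mul_equiv (u v : C.Rep) : MatEquiv (u.mul v).mat (tens u.mat v.mat) :=
  .of_equiv finProdFinEquiv.symm fun _ _ => rfl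

instance : Zero C.Classes := ⟨Quotient.mk _ ⟨_, _, C.zero⟩⟩

instance : One C.Classes := ⟨Quotient.mk _ ⟨_, _, C.one⟩⟩

instance : Add C.Classes :=
  ⟨Quotient.map₂ Rep.add fun u u' h v v' h' =>
    (u.add_equiv v).trans ((MatEquiv.dsum h h').trans (u'.add_equiv v').symm)⟩

instance : Mul C.Classes :=
  ⟨Quotient.map₂ Rep.mul fun u u' h v v' h' =>
    (u.mul_equiv v).trans ((MatEquiv.tens h h').trans (u'.mul_equiv v').symm)⟩

instance : Semiring C.Classes where
  add_assoc := by
    rintro ⟨u⟩ ⟨v⟩ ⟨w⟩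
    refine Quotient.sound (?_ : MatEquiv _ _)
    refine ((Rep.add_equiv _ _).trans (.dsum (Rep.add_equiv _ _) (.refl _))).trans (.trans ?_
      ((Rep.add_equiv _ _).trans (.dsum (.refl _) (Rep.add_equiv _ _))).symm)
    refine .of_equiv (Equiv.sumAssoc _ _ _) ?_
    rintro ((i | i) | i) ((j | j) | j) <;> rfl
  zero_add := by
    rintro ⟨u⟩
    refine Quotient.sound (?_ : MatEquiv _ _)
    refine (Rep.add_equiv _ _).trans (.of_equiv (Equiv.emptySum _ _) ?_)
    rintro (i | i) (j | j)
    · exact i.elim0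
    · exact i.elim0
    · exact j.elim0
    · rfl
  add_zero := by
    rintro ⟨u⟩
    refine Quotient.sound (?_ : MatEquiv _ _)
    refine (Rep.add_equiv _ _).trans (.of_equiv (Equiv.sumEmpty _ _) ?_)
    rintro (i | i) (j | j)
    · rfl
    · exact j.elim0
    · exact i.elim0
    · exact i.elim0
  add_comm := by
    rintro ⟨u⟩ ⟨v⟩
    refine Quotient.sound (?_ : MatEquiv _ _)
    refine (Rep.add_equiv _ _).trans (.trans ?_ (Rep.add_equiv _ _).symm)
    refine .of_equiv (Equiv.sumComm _ _) ?_
    rintro (i | i) (j | j) <;> rfl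
  nsmul := nsmulRec
  left_distrib := by
    rintro ⟨u⟩ ⟨v⟩ ⟨w⟩
    refine Quotient.sound (?_ : MatEquiv _ _)
    refine ((Rep.mul_equiv _ _).trans (.tens (.refl _) (Rep.add_equiv _ _))).trans (.trans ?_
      ((Rep.add_equiv _ _).trans (.dsum (Rep.mul_equiv _ _) (Rep.mul_equiv _ _))).symm)
    refine .of_equiv (Equiv.prodSumDistrib _ _ _) ?_
    rintro ⟨i, i' | i'⟩ ⟨j, j' | j'⟩ <;> simp [dsum, tens]
  right_distrib := by
    rintro ⟨u⟩ ⟨v⟩ ⟨w⟩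
    refine Quotient.sound (?_ : MatEquiv _ _)
    refine ((Rep.mul_equiv _ _).trans (.tens (Rep.add_equiv _ _) (.refl _))).trans (.trans ?_
      ((Rep.add_equiv _ _).trans (.dsum (Rep.mul_equiv _ _) (Rep.mul_equiv _ _))).symm)
    refine .of_equiv (Equiv.sumProdDistrib _ _ _) ?_
    rintro ⟨i | i, i'⟩ ⟨j | j, j'⟩ <;> simp [dsum, tens]
  zero_mul := by
    rintro ⟨u⟩
    refine Quotient.sound (?_ : MatEquiv _ _)
    refine (Rep.mul_equiv _ _).trans (.of_equiv (Equiv.equivOfIsEmpty _ _) ?_)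
    rintro ⟨i, -⟩
    exact i.elim0
  mul_zero := by
    rintro ⟨u⟩
    refine Quotient.sound (?_ : MatEquiv _ _)
    refine (Rep.mul_equiv _ _).trans (.of_equiv (Equiv.equivOfIsEmpty _ _) ?_)
    rintro ⟨-, i⟩
    exact i.elim0
  mul_assoc := by
    rintro ⟨u⟩ ⟨v⟩ ⟨w⟩
    refine Quotient.sound (?_ : MatEquiv _ _)
    refine ((Rep.mul_equiv _ _).trans (.tens (Rep.mul_equiv _ _) (.refl _))).trans (.trans ?_
      ((Rep.mul_equiv _ _).trans (.tens (.refl _) (Rep.mul_equiv _ _))).symm)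
    exact .of_equiv (Equiv.prodAssoc _ _ _) fun i j => mul_assoc _ _ _
  one_mul := by
    rintro ⟨u⟩
    refine Quotient.sound (?_ : MatEquiv _ _)
    refine (Rep.mul_equiv _ _).trans (.of_equiv (Equiv.uniqueProd _ (Fin 1)) ?_)
    rintro ⟨i, i'⟩ ⟨j, j'⟩
    obtain rfl := Subsingleton.elim i j
    simp [tens]
  mul_one := by
    rintro ⟨u⟩
    refine Quotient.sound (?_ : MatEquiv _ _)
    refine (Rep.mul_equiv _ _).trans (.of_equiv (Equiv.prodUnique _ (Fin 1)) ?_)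
    rintro ⟨i, i'⟩ ⟨j, j'⟩
    obtain rfl := Subsingleton.elim i' j'
    simp [tens]

end RepClass

/-! ### Corepresentations of a bialgebra -/

section Corep

variable (H : Type*) [Ring H] [Bialgebra ℂ H]

/-- A matrix `u` over a bialgebra is a (finite-dimensional) corepresentation if
`Δ(u i j) = ∑ k, u i k ⊗ u k j` and `ε(u i j) = δ i j`. -/
def IsCorep {ι : Type*} [Fintype ι] [DecidableEq ι] (u : Matrix ι ι H) : Prop :=
  (∀ i j, Coalgebra.comul (R := ℂ) (u i j) = ∑ k, u i k ⊗ₜ[ℂ] u k j) ∧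
  ∀ i j, Coalgebra.counit (R := ℂ) (u i j) = if i = j then 1 else 0

variable {H}

lemma IsCorep.reindex {ι κ : Type*} [Fintype ι] [DecidableEq ι] [Fintype κ] [DecidableEq κ]
    {u : Matrix ι ι H} (h : IsCorep H u) (e : ι ≃ κ) : IsCorep H (Matrix.reindex e e u) := by
  refine ⟨fun i j => ?_, fun i j => ?_⟩
  · simp only [Matrix.reindex_apply, Matrix.submatrix_apply, h.1]
    exact (Equiv.sum_comp e.symm fun k => u (e.symm i) k ⊗ₜ[ℂ] u k (e.symm j)).symm
  · simp [h.2]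

lemma IsCorep.dsum {ι κ : Type*} [Fintype ι] [DecidableEq ι] [Fintype κ] [DecidableEq κ]
    {u : Matrix ι ι H} {v : Matrix κ κ H} (h : IsCorep H u) (h' : IsCorep H v) :
    IsCorep H (Fusion.dsum u v) := by
  refine ⟨?_, ?_⟩
  · rintro (i | i) (j | j) <;> simp [Fusion.dsum, h.1, h'.1]
  · rintro (i | i) (j | j) <;> simp [Fusion.dsum, h.2, h'.2]

lemma IsCorep.tens {ι κ : Type*} [Fintype ι] [DecidableEq ι] [Fintype κ] [DecidableEq κ]
    {u : Matrix ι ι H} {v : Matrix κ κ H} (h : IsCorep H u) (h' : IsCorep H v) :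
    IsCorep H (Fusion.tens u v) := by
  refine ⟨?_, ?_⟩
  · rintro ⟨i, i'⟩ ⟨j, j'⟩
    simp [Fusion.tens, h.1, h'.1, Finset.sum_mul_sum, Fintype.sum_prod_type]
  · rintro ⟨i, i'⟩ ⟨j, j'⟩
    simp only [Fusion.tens, Bialgebra.counit_mul, h.2, h'.2, Prod.mk.injEq]
    split_ifs <;> simp_all

variable (H)

/-- The class of corepresentations of the bialgebra `H`. -/
def corepClass : RepClass H where
  IsRep u := IsCorep H u
  zero := ⟨fun i => i.elim0, fun i => i.elim0⟩
  one := ⟨fun i j => by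
      obtain rfl := Subsingleton.elim i j
      simp [Algebra.TensorProduct.one_def, Matrix.one_apply, Subsingleton.elim _ i], fun i j => by
      obtain rfl := Subsingleton.elim i j
      simp⟩
  add h h' := (h.dsum h').reindex _
  mul h h' := (h.tens h').reindex _

/-- The fusion semiring of `H`: equivalence classes of finite-dimensional corepresentations,
with direct sum and tensor product. -/
abbrev FusionSemiring : Type _ := (corepClass H).Classes

end Corep

/-! ### Continuous representations of a topological group -/

section Group

variable (K : Type*) [Group K] [TopologicalSpace K]

/-- A matrix `u` of continuous functions on `K` is a continuous finite-dimensional complex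
representation if `g ↦ u(g)` is multiplicative and unital. -/
def IsGroupRep {n : ℕ} (u : Matrix (Fin n) (Fin n) C(K, ℂ)) : Prop :=
  (∀ g h : K, (u.map fun f => f (g * h)) = (u.map fun f => f g) * (u.map fun f => f h)) ∧
  (u.map fun f => f 1) = 1

/-- The class of continuous finite-dimensional complex representations of `K`. -/
def groupRepClass : RepClass C(K, ℂ) where
  IsRep u := IsGroupRep K u
  zero := ⟨fun g h => by ext i; exact i.elim0, by ext i; exact i.elim0⟩
  one := ⟨fun g h => by
      ext i j
      obtain rfl := Subsingleton.elim i j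
      simp [Matrix.mul_apply, Subsingleton.elim _ i], by
      ext i j
      obtain rfl := Subsingleton.elim i j
      simp⟩
  add {m n u v} h h' := by
    refine ⟨fun g k => ?_, ?_⟩
    · have e : ∀ x : K, ((Matrix.reindex finSumFinEquiv finSumFinEquiv (dsum u v)).map
          fun f => f x) = Matrix.reindex finSumFinEquiv finSumFinEquiv
            (Matrix.fromBlocks (u.map fun f => f x) 0 0 (v.map fun f => f x)) := by
        intro x
        ext i j
        obtain ⟨i, rfl⟩ := finSumFinEquiv.surjective i
        obtain ⟨j, rfl⟩ := finSumFinEquiv.surjective j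
        rcases i with i | i <;> rcases j with j | j <;> simp [dsum]
      rw [e, e, e, h.1, h'.1]
      simp [Matrix.submatrix_mul_equiv, Matrix.fromBlocks_multiply]
    · ext i j
      obtain ⟨i, rfl⟩ := finSumFinEquiv.surjective i
      obtain ⟨j, rfl⟩ := finSumFinEquiv.surjective j
      have a := fun i j => congrFun (congrFun h.2 i) j
      have b := fun i j => congrFun (congrFun h'.2 i) j
      simp only [Matrix.map_apply] at a b
      rcases i with i | i <;> rcases j with j | j <;>
        simp [dsum, a, b, Matrix.one_apply, -finSumFinEquiv_apply_left,
          -finSumFinEquiv_apply_right]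
  mul {m n u v} h h' := by
    have e : ∀ x : K, ((Matrix.reindex finProdFinEquiv finProdFinEquiv (tens u v)).map
        fun f => f x) = Matrix.reindex finProdFinEquiv finProdFinEquiv
          ((u.map fun f => f x) ⊗ₖ (v.map fun f => f x)) := by
      intro x
      ext i j
      simp [tens]
    refine ⟨fun g k => ?_, ?_⟩
    · rw [e, e, e, h.1, h'.1, Matrix.mul_kronecker_mul]
      simp [Matrix.submatrix_mul_equiv]
    · rw [e, h.2, h'.2, Matrix.one_kronecker_one]
      simp

/-- The fusion semiring of a compact group `K`: equivalence classes of continuous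
finite-dimensional complex representations, with direct sum and tensor product. -/
abbrev GroupFusionSemiring : Type _ := (groupRepClass K).Classes

end Group

/-! ### The algebra `𝒜ₙ(G)` -/

section Wreath

variable (n : ℕ) (G : Type*) [Group G]

/-- The generator `a_{ij}(g)` of the free algebra. -/
abbrev gen {n : ℕ} {G : Type*} (i j : Fin n) (g : G) : FreeAlgebra ℂ (Fin n × Fin n × G) :=
  FreeAlgebra.ι ℂ (i, j, g)

/-- The defining relations of `𝒜ₙ(G)`. -/
inductive Rel : FreeAlgebra ℂ (Fin n × Fin n × G) → FreeAlgebra ℂ (Fin n × Fin n × G) → Prop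
  | row (i j k : Fin n) (g h : G) :
      Rel (gen i j g * gen i k h) (if j = k then gen i j (g * h) else 0)
  | col (i j k : Fin n) (g h : G) :
      Rel (gen j i g * gen k i h) (if j = k then gen j i (g * h) else 0)
  | row_sum (i : Fin n) : Rel (∑ l, gen i l (1 : G)) 1
  | col_sum (i : Fin n) : Rel (∑ l, gen l i (1 : G)) 1

/-- The universal complex algebra `𝒜ₙ(G)` with generators `a_{ij}(g)` and the relations `Rel`. -/
def WreathAlg : Type _ := RingQuot (Rel n G)

instance : Ring (WreathAlg n G) := inferInstanceAs (Ring (RingQuot (Rel n G)))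

instance : Algebra ℂ (WreathAlg n G) := inferInstanceAs (Algebra ℂ (RingQuot (Rel n G)))

namespace WreathAlg

variable {n G}

/-- The generator `a_{ij}(g)` of `𝒜ₙ(G)`. -/
def a (i j : Fin n) (g : G) : WreathAlg n G := RingQuot.mkAlgHom ℂ (Rel n G) (gen i j g)

lemma a_row (i j k : Fin n) (g h : G) :
    a i j g * a i k h = if j = k then a i j (g * h) else 0 := by
  have := RingQuot.mkAlgHom_rel ℂ (Rel.row i j k g h)
  rw [map_mul] at this
  refine this.trans ?_
  split_ifs
  · rfl
  · exact map_zero _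

lemma a_col (i j k : Fin n) (g h : G) :
    a j i g * a k i h = if j = k then a j i (g * h) else 0 := by
  have := RingQuot.mkAlgHom_rel ℂ (Rel.col i j k g h)
  rw [map_mul] at this
  refine this.trans ?_
  split_ifs
  · rfl
  · exact map_zero _

lemma a_row_sum (i : Fin n) : ∑ l, a i l (1 : G) = 1 := by
  have := RingQuot.mkAlgHom_rel ℂ (Rel.row_sum (G := G) i)
  rw [map_sum, map_one] at this
  exact this

lemma a_col_sum (i : Fin n) : ∑ l, a l i (1 : G) = 1 := by
  have := RingQuot.mkAlgHom_rel ℂ (Rel.col_sum (G := G) i)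
  rw [map_sum, map_one] at this
  exact this

/-- The universal property of `𝒜ₙ(G)`. -/
def lift {B : Type*} [Semiring B] [Algebra ℂ B] (b : Fin n → Fin n → G → B)
    (h1 : ∀ i j k g h, b i j g * b i k h = if j = k then b i j (g * h) else 0)
    (h2 : ∀ i j k g h, b j i g * b k i h = if j = k then b j i (g * h) else 0)
    (h3 : ∀ i, ∑ l, b i l 1 = 1) (h4 : ∀ i, ∑ l, b l i 1 = 1) : WreathAlg n G →ₐ[ℂ] B :=
  RingQuot.liftAlgHom ℂ ⟨FreeAlgebra.lift ℂ fun p => b p.1 p.2.1 p.2.2, by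
    rintro _ _ (⟨i, j, k, g, h⟩ | ⟨i, j, k, g, h⟩ | i | i)
    · rw [map_mul, FreeAlgebra.lift_ι_apply, FreeAlgebra.lift_ι_apply, h1]
      split_ifs
      · rw [FreeAlgebra.lift_ι_apply]
      · rw [map_zero]
    · rw [map_mul, FreeAlgebra.lift_ι_apply, FreeAlgebra.lift_ι_apply, h2]
      split_ifs
      · rw [FreeAlgebra.lift_ι_apply]
      · rw [map_zero]
    · simp [h3]
    · simp [h4]⟩

@[simp]
lemma lift_a {B : Type*} [Semiring B] [Algebra ℂ B] (b : Fin n → Fin n → G → B) (h1 h2 h3 h4)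
    (i j : Fin n) (g : G) : lift b h1 h2 h3 h4 (a i j g) = b i j g := by
  unfold lift a
  refine (RingQuot.liftAlgHom_mkAlgHom_apply ℂ _ _ _).trans ?_
  exact FreeAlgebra.lift_ι_apply _ _

lemma hom_ext {B : Type*} [Semiring B] [Algebra ℂ B] {f f' : WreathAlg n G →ₐ[ℂ] B}
    (h : ∀ i j g, f (a i j g) = f' (a i j g)) : f = f' := by
  refine RingQuot.ringQuot_ext' ℂ _ _ (FreeAlgebra.hom_ext ?_)
  funext p
  exact h p.1 p.2.1 p.2.2

/-- The comultiplication of `𝒜ₙ(G)`: `Δ(a_{ij}(g)) = ∑ k, a_{ik}(g) ⊗ a_{kj}(g)`. -/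
def comulHom : WreathAlg n G →ₐ[ℂ] WreathAlg n G ⊗[ℂ] WreathAlg n G :=
  lift (fun i j g => ∑ k, a i k g ⊗ₜ[ℂ] a k j g)
    (fun i j k g h => by
      simp only [Finset.sum_mul_sum, Algebra.TensorProduct.tmul_mul_tmul, a_row i]
      simp [TensorProduct.ite_tmul, a_row]
      split_ifs <;> simp)
    (fun i j k g h => by
      simp only [Finset.sum_mul_sum, Algebra.TensorProduct.tmul_mul_tmul, a_col i]
      simp [TensorProduct.tmul_ite, a_col]
      split_ifs <;> simp)
    (fun i => by
      rw [Finset.sum_comm]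
      simp_rw [← TensorProduct.tmul_sum, a_row_sum, ← TensorProduct.sum_tmul, a_row_sum]
      rfl)
    (fun i => by
      rw [Finset.sum_comm]
      simp_rw [← TensorProduct.sum_tmul, a_col_sum, ← TensorProduct.tmul_sum, a_col_sum]
      rfl)

/-- The counit of `𝒜ₙ(G)`: `ε(a_{ij}(g)) = δ i j`. -/
def counitHom : WreathAlg n G →ₐ[ℂ] ℂ :=
  lift (fun i j _ => if i = j then 1 else 0)
    (fun i j k g h => by split_ifs <;> simp_all)
    (fun i j k g h => by split_ifs <;> simp_all)
    (fun i => by simp) (fun i => by simp)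

@[simp]
lemma comulHom_a (i j : Fin n) (g : G) :
    comulHom (a i j g) = ∑ k, a i k g ⊗ₜ[ℂ] a k j g := by
  simp [comulHom]

@[simp]
lemma counitHom_a (i j : Fin n) (g : G) :
    counitHom (a i j g) = if i = j then 1 else 0 := by
  simp [counitHom]

instance : Bialgebra ℂ (WreathAlg n G) :=
  Bialgebra.ofAlgHom comulHom counitHom
    (hom_ext fun i j g => by
      simp [TensorProduct.sum_tmul, TensorProduct.tmul_sum]
      exact Finset.sum_comm)
    (hom_ext fun i j g => by simp [TensorProduct.ite_tmul])
    (hom_ext fun i j g => by simp [TensorProduct.tmul_ite])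

end WreathAlg

end Wreath

end Fusion

end

/-!
The algebra `𝒜₂(G)` is the sum of two copies of the group algebra of the free product `G * G`, cut
out by the central idempotents `a₁₁(1)` and `a₁₂(1)`.

*Commutativity forces `|G| = 2`.* The trace of a corepresentation depends only on its class, even
though the algebra is not commutative. If `g, h ≠ 1` are distinct, the character of the product of
the fundamental corepresentations at `g` and `h` contains the word `g₁h₂` of `G * G`, and the one
of the opposite product does not (`WreathAlg.eq_of_commutative`). So `G` has at most two elements.

*The case `G = {1, γ}`.* Here `G * G` is the infinite dihedral group, whose elements are the
alternating words in two involutions `s, t` and are indexed by `ℤ` through their signed length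
(`WreathAlg.word`). Although `𝒜₂(G)` is not commutative, it is isomorphic as a coalgebra to the
ring of trigonometric polynomials on `O(2)`: the word of signed length `k` in either summand
corresponds to the function `z ^ k` on a connected component of `O(2)`, where `z` is the first
column. This isomorphism is `x ↦ x · 1` for an action of `𝒜₂(G)` on the functions on `O(2)`
(`WreathAlg.toO2`). It is not multiplicative, but the action is linear over the functions that are
invariant under conjugation with a reflection, in particular over characters
(`WreathAlg.toO2_mul`).

Being an isomorphism of coalgebras, it puts the corepresentations of `𝒜₂(G)` in bijection with the
representations of `O(2)`, up to equivalence and compatibly with direct sums; for this, Fourier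
analysis on the rotations shows that the entries of every continuous representation of `O(2)` are
trigonometric polynomials (`IsGroupRep.mem_span`). Tensor products correspond to representations
with the same character, and these are equivalent, since the character determines the multiplicities
in a representation of `O(2)` (`IsGroupRep.matEquiv_of_trace_eq`). Hence the fusion semirings are
isomorphic (`WreathAlg.fusionEquiv`), and that of `O(2)` is commutative because functions commute.
-/

noncomputable section

namespace Fusion

/-! ### Characters -/

/-- The character of a matrix over `A` is its trace; since complex scalars are central, equivalent
matrices have the same character even when `A` is not commutative. -/
lemma MatEquiv.trace_eq {A ι κ : Type*} [Semiring A] [Algebra ℂ A] [Fintype ι] [Fintype κ]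
    [DecidableEq ι] [DecidableEq κ] {u : Matrix ι ι A} {v : Matrix κ κ A} (h : MatEquiv u v) :
    u.trace = v.trace := by
  obtain ⟨T, S, h1, h2, h3⟩ := h
  have hu : u = scal A S * (v * scal A T) := by
    rw [← h3, ← Matrix.mul_assoc, ← scal_mul, h2, scal_one, Matrix.one_mul]
  have hv : v = (v * scal A T) * scal A S := by
    rw [Matrix.mul_assoc, ← scal_mul, h1, scal_one, Matrix.mul_one]
  rw [hv]
  nth_rewrite 1 [hu]
  simp only [Matrix.trace, Matrix.diag, Matrix.mul_apply (M := scal A S),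
    Matrix.mul_apply (N := scal A S)]
  rw [Finset.sum_comm]
  simp [scal, Algebra.commutes]

lemma trace_tens {A ι κ : Type*} [Semiring A] [Fintype ι] [Fintype κ]
    (u : Matrix ι ι A) (v : Matrix κ κ A) : (tens u v).trace = u.trace * v.trace := by
  simp [tens, Matrix.trace, Fintype.sum_prod_type, Finset.sum_mul_sum]

/-! ### A commutative fusion semiring forces the group to have two elements -/

namespace WreathAlg

variable {G : Type*} [Group G]

/-- The two-dimensional corepresentation `(a_{ij}(g))` of `𝒜₂(G)`. -/
def fundRep (g : G) : (corepClass (WreathAlg 2 G)).Rep where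
  dim := 2
  mat := fun i j => a i j g
  isRep := ⟨fun i j => comulHom_a i j g, fun i j => counitHom_a i j g⟩

/-- Two homomorphisms `α, β : G → Q` induce an algebra homomorphism `𝒜₂(G) → ℂ[Q]` with
`a₁₁(g) ↦ α(g)`, `a₂₂(g) ↦ β(g)` that kills `a₁₂(g)` and `a₂₁(g)`. -/
def toMonoidAlgebra {Q : Type*} [Group Q] (α β : G →* Q) :
    WreathAlg 2 G →ₐ[ℂ] MonoidAlgebra ℂ Q :=
  lift (fun i j g => if i = j then MonoidAlgebra.single (if i = 0 then α g else β g) 1 else 0)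
    (fun i j k g h => by
      fin_cases i <;> fin_cases j <;> fin_cases k <;> simp [MonoidAlgebra.single_mul_single])
    (fun i j k g h => by
      fin_cases i <;> fin_cases j <;> fin_cases k <;> simp [MonoidAlgebra.single_mul_single])
    (fun i => by fin_cases i <;> simp [MonoidAlgebra.one_def])
    (fun i => by fin_cases i <;> simp [MonoidAlgebra.one_def])

/-- The left regular permutation representation of `G`, with an additional fixed point. -/
def regOption : G →* Equiv.Perm (Option G) where
  toFun g := Equiv.optionCongr (Equiv.mulLeft g)
  map_one' := by ext (_ | x) <;> simp
  map_mul' g h := by ext (_ | x) <;> simp [mul_assoc]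

open Classical in
/-- The representation `regOption` with the fixed point interchanged with the unit of `G`. -/
def regOption' : G →* Equiv.Perm (Option G) :=
  (MulAut.conj (Equiv.swap none (some 1))).toMonoidHom.comp regOption

/-- The letters `g` in the first and `h` in the second copy of `G` do not commute in `G * G`. -/
lemma regOption_mul_regOption'_ne {g h : G} (hg : g ≠ 1) (hh : h ≠ 1) :
    regOption g * regOption' h ≠ regOption' h * regOption g := by
  classical
  intro e
  have e1 := congrArg (fun f : Equiv.Perm (Option G) => f (some 1)) e
  have hg' : (some g : Option G) ≠ some 1 := by simpa using hg
  by_cases hgh : h * g = 1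
  · simp [regOption, regOption', Equiv.swap_apply_of_ne_of_ne _ hg', hgh] at e1
  · have hgh' : (some (h * g) : Option G) ≠ some 1 := by simpa using hgh
    simp [regOption, regOption', Equiv.swap_apply_of_ne_of_ne _ hg',
      Equiv.swap_apply_of_ne_of_ne _ hgh', hh] at e1

/-- If the fusion semiring is commutative, then `G` has at most one element besides `1`: for
distinct `g, h ≠ 1` the word `g₁h₂` occurs in the character of the product of the classes of
`g` and `h`, but not in that of the opposite product. -/
theorem eq_of_commutative (H : ∀ x y : FusionSemiring (WreathAlg 2 G), x * y = y * x)
    {g h : G} (hg : g ≠ 1) (hh : h ≠ 1) : g = h := by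
  classical
  by_contra hne
  have e : MatEquiv ((fundRep g).mul (fundRep h)).mat ((fundRep h).mul (fundRep g)).mat :=
    Quotient.exact (H (Quotient.mk _ (fundRep g)) (Quotient.mk _ (fundRep h)))
  have e2 := (((RepClass.Rep.mul_equiv _ _).symm.trans e).trans
    (RepClass.Rep.mul_equiv _ _)).trace_eq
  rw [trace_tens, trace_tens] at e2
  -- The two factors `G` and the permutations suffice to tell `g₁h₂` from all other words in the
  -- two characters.
  let α : G →* G × G × Equiv.Perm (Option G) :=
    (MonoidHom.id G).prod ((1 : G →* G).prod regOption)
  let β : G →* G × G × Equiv.Perm (Option G) :=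
    (1 : G →* G).prod ((MonoidHom.id G).prod regOption')
  have e3 := congrArg (toMonoidAlgebra α β) e2
  have tr : ∀ x : G, toMonoidAlgebra α β (Matrix.trace (fundRep x).mat) =
      MonoidAlgebra.single (α x) 1 + MonoidAlgebra.single (β x) 1 := by
    intro x
    have : (fundRep x).mat.trace = a 0 0 x + a 1 1 x := Fin.sum_univ_two _
    simp [this, toMonoidAlgebra]
  rw [map_mul, map_mul, tr, tr] at e3
  have e4 := congrArg (fun f : MonoidAlgebra ℂ (G × G × Equiv.Perm (Option G)) =>
    f.coeff (α g * β h)) e3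
  have n1 : α h * α g ≠ α g * β h := fun w => hh (by simpa [α, β] using (congrArg (·.2.1) w).symm)
  have n2 : α h * β g ≠ α g * β h := fun w => hne (by simpa [α, β] using (congrArg (·.1) w).symm)
  have n3 : β h * α g ≠ α g * β h := fun w =>
    regOption_mul_regOption'_ne hg hh (by simpa [α, β] using (congrArg (·.2.2) w).symm)
  have n4 : β h * β g ≠ α g * β h := fun w => hg (by simpa [α, β] using (congrArg (·.1) w).symm)
  have n5 : α g * α h ≠ α g * β h := fun w => hh (by simpa [α, β] using (congrArg (·.2.1) w).symm)
  have n6 : β g * α h ≠ α g * β h := fun w => hne (by simpa [α, β] using (congrArg (·.1) w).symm)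
  have n7 : β g * β h ≠ α g * β h := fun w => hg (by simpa [α, β] using (congrArg (·.1) w).symm)
  simp [mul_add, add_mul, MonoidAlgebra.single_mul_single, MonoidAlgebra.coeff_add,
    MonoidAlgebra.coeff_single, n1, n2, n3, n4, n5, n6, n7] at e4

end WreathAlg

/-! ### The algebra `𝒜₂(G)` of a group with two elements -/

/-- The alternating word `x y x y ⋯` of length `n`. -/
def altWord {M : Type*} [Monoid M] (x y : M) : ℕ → M
  | 0 => 1
  | n + 1 => altWord x y n * if Even n then x else y

namespace WreathAlg

variable {G : Type*} [Group G]

lemma adjoin_gen (n : ℕ) :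
    Algebra.adjoin ℂ {x : WreathAlg n G | ∃ i j g, x = a i j g} = ⊤ := by
  set B := Algebra.adjoin ℂ {x : WreathAlg n G | ∃ i j g, x = a i j g}
  have hmem : ∀ i j g, (a i j g : WreathAlg n G) ∈ B := fun i j g =>
    Algebra.subset_adjoin ⟨i, j, g, rfl⟩
  let f : WreathAlg n G →ₐ[ℂ] B := lift (fun i j g => ⟨a i j g, hmem i j g⟩)
    (fun i j k g h => by
      apply Subtype.ext
      simp only [MulMemClass.mk_mul_mk, a_row]
      split_ifs <;> rfl)
    (fun i j k g h => by
      apply Subtype.ext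
      simp only [MulMemClass.mk_mul_mk, a_col]
      split_ifs <;> rfl)
    (fun i => by
      apply Subtype.ext
      simpa using a_row_sum i)
    (fun i => by
      apply Subtype.ext
      simpa using a_col_sum i)
  have hf : B.val.comp f = AlgHom.id ℂ _ := hom_ext fun i j g => by simp [f]
  refine eq_top_iff.2 fun x _ => ?_
  have := DFunLike.congr_fun hf x
  simp only [AlgHom.comp_apply, AlgHom.id_apply, Subalgebra.coe_val] at this
  rw [← this]
  exact (f x).2

/-- A subset of `𝒜₂(G)` containing the scalars and the generators, and closed under sums and
products, is everything. -/
lemma induction {n : ℕ} {P : WreathAlg n G → Prop} (x : WreathAlg n G)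
    (hc : ∀ c : ℂ, P (algebraMap ℂ _ c)) (ha : ∀ i j g, P (a i j g))
    (hadd : ∀ x y, P x → P y → P (x + y)) (hmul : ∀ x y, P x → P y → P (x * y)) : P x := by
  have hx : x ∈ Algebra.adjoin ℂ {x : WreathAlg n G | ∃ i j g, x = a i j g} := by
    rw [adjoin_gen]; trivial
  induction hx using Algebra.adjoin_induction with
  | mem x hx => obtain ⟨i, j, g, rfl⟩ := hx; exact ha i j g
  | algebraMap c => exact hc c
  | add x y _ _ h h' => exact hadd x y h h'
  | mul x y _ _ h h' => exact hmul x y h h'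

/-- The two complementary central idempotents `a₁₁(1) = a₂₂(1)` and `a₁₂(1) = a₂₁(1)` of
`𝒜₂(G)`. -/
def idem (G : Type*) [Group G] (ε : Bool) : WreathAlg 2 G := a 0 (if ε then 0 else 1) 1

lemma idem_true : idem G true = a 0 0 1 := rfl

lemma idem_false : idem G false = a 0 1 1 := rfl

lemma idem_add : idem G true + idem G false = 1 := by
  have := a_row_sum (n := 2) (G := G) 0
  rwa [Fin.sum_univ_two] at this

lemma idem_true' : idem G true = a 1 1 1 := by
  have h1 := a_row_sum (n := 2) (G := G) 0
  have h2 := a_col_sum (n := 2) (G := G) 1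
  rw [Fin.sum_univ_two] at h1 h2
  rw [idem_true]
  exact add_right_cancel (h1.trans ((add_comm _ _).trans h2).symm)

lemma idem_false' : idem G false = a 1 0 1 := by
  have h1 := a_row_sum (n := 2) (G := G) 0
  have h2 := a_col_sum (n := 2) (G := G) 0
  rw [Fin.sum_univ_two] at h1 h2
  exact add_left_cancel (h1.trans h2.symm)

lemma idem_eq (ε : Bool) (i : Fin 2) :
    idem G ε = a i (if ε then i else 1 - i) 1 := by
  fin_cases i <;> cases ε
  · exact idem_false
  · exact idem_true
  · exact idem_false'
  · exact idem_true'

lemma idem_mul_idem (ε ε' : Bool) :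
    idem G ε * idem G ε' = if ε = ε' then idem G ε else 0 := by
  cases ε <;> cases ε' <;> simp [idem, a_row]

lemma idem_mul_a (ε : Bool) (i j : Fin 2) (g : G) :
    idem G ε * a i j g = if (i = j ↔ ε = true) then a i j g else 0 := by
  rw [idem_eq ε i, a_row]
  fin_cases i <;> fin_cases j <;> cases ε <;> simp

lemma a_mul_idem (ε : Bool) (i j : Fin 2) (g : G) :
    a i j g * idem G ε = if (i = j ↔ ε = true) then a i j g else 0 := by
  rw [idem_eq ε i, a_row]
  fin_cases i <;> fin_cases j <;> cases ε <;> simp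

lemma idem_comm (ε : Bool) (x : WreathAlg 2 G) : idem G ε * x = x * idem G ε := by
  induction x using induction with
  | hc c => exact (Algebra.commutes c _).symm
  | ha i j g => rw [idem_mul_a, a_mul_idem]
  | hadd x y h h' => rw [mul_add, add_mul, h, h']
  | hmul x y h h' => rw [← mul_assoc, h, mul_assoc, h', mul_assoc]

/-- For an involution `γ ∈ G` the involutions `s = a₁₁(γ) + a₁₂(γ)` and
`t = a₂₁(γ) + a₂₂(γ)` of `𝒜₂(G)` generate an infinite dihedral group; `letter γ k` is `s` for
even and `t` for odd `k`. -/
def letter (γ : G) (k : ℤ) : WreathAlg 2 G :=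
  if Even k then a 0 0 γ + a 0 1 γ else a 1 0 γ + a 1 1 γ

variable {γ : G}

lemma letter_even {k : ℤ} (h : Even k) : letter γ k = a 0 0 γ + a 0 1 γ := if_pos h

lemma letter_odd {k : ℤ} (h : ¬ Even k) : letter γ k = a 1 0 γ + a 1 1 γ := if_neg h

lemma letter_congr {k l : ℤ} (h : Even k ↔ Even l) : letter γ k = letter γ l := by
  simp [letter, h]

lemma letter_mul_self (hγ : γ * γ = 1) (k : ℤ) : letter γ k * letter γ k = 1 := by
  have h0 := a_row_sum (n := 2) (G := G) 0
  have h1 := a_row_sum (n := 2) (G := G) 1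
  rw [Fin.sum_univ_two] at h0 h1
  by_cases h : Even k
  · simp [letter_even h, mul_add, add_mul, a_row, hγ, h0]
  · simp [letter_odd h, mul_add, add_mul, a_row, hγ, h1]

lemma idem_mul_letter (ε : Bool) (k : ℤ) :
    idem G ε * letter γ k =
      if Even k then a 0 (if ε then 0 else 1) γ else a 1 (if ε then 1 else 0) γ := by
  by_cases h : Even k <;> cases ε <;> simp [letter, h, mul_add, idem_mul_a]

/-- The elements of the infinite dihedral group generated by `s` and `t`, indexed by `ℤ`:
`word γ k` is the reduced word of length `|k|` starting with `s` if `k > 0` and with `t` if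
`k < 0`. -/
def word (γ : G) : ℤ → WreathAlg 2 G
  | .ofNat n => altWord (letter γ 0) (letter γ 1) n
  | .negSucc n => altWord (letter γ 1) (letter γ 0) (n + 1)

lemma word_zero : word γ 0 = 1 := rfl

lemma word_add_one (hγ : γ * γ = 1) (k : ℤ) : word γ (k + 1) = word γ k * letter γ k := by
  cases k with
  | ofNat n =>
    change altWord _ _ (n + 1) = altWord _ _ n * _
    rw [altWord]
    congr 1
    by_cases h : Even n
    · rw [if_pos h]; exact letter_congr (by simp [h])
    · rw [if_neg h]; exact letter_congr (by simp [h])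
  | negSucc n =>
    have h1 : word γ (Int.negSucc n + 1) = altWord (letter γ 1) (letter γ 0) n := by
      cases n <;> rfl
    have h2 : (if Even n then letter γ 1 else letter γ 0) = letter γ (Int.negSucc n) := by
      have : Even (Int.negSucc n) ↔ ¬ Even n := by
        rw [Int.negSucc_eq, even_neg, Int.even_add_one, Int.even_coe_nat]
      by_cases h : Even n
      · rw [if_pos h]; exact letter_congr (by simp [h, this])
      · rw [if_neg h]; exact letter_congr (by simp [h, this])
    rw [h1]
    change _ = altWord _ _ (n + 1) * _
    rw [altWord, h2, mul_assoc, letter_mul_self hγ, mul_one]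

lemma word_sub_one (hγ : γ * γ = 1) (k : ℤ) : word γ (k - 1) = word γ k * letter γ (k - 1) := by
  have h := word_add_one hγ (k - 1)
  rw [sub_add_cancel] at h
  rw [h, mul_assoc, letter_mul_self hγ, mul_one]

/-- The elements `p_ε w`, for a central idempotent `p_ε` and a word `w`, span `𝒜₂(ℤ/2)`. -/
lemma span_idem_mul_word (hγ : γ * γ = 1) (hG : ∀ g : G, g = 1 ∨ g = γ) :
    Submodule.span ℂ (Set.range fun x : Bool × ℤ => idem G x.1 * word γ x.2) = ⊤ := by
  set V := Submodule.span ℂ (Set.range fun x : Bool × ℤ => idem G x.1 * word γ x.2)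
  have hV : ∀ ε k, idem G ε * word γ k ∈ V := fun ε k => Submodule.subset_span ⟨(ε, k), rfl⟩
  have hl : ∀ x ∈ V, ∀ k, x * letter γ k ∈ V := by
    intro x hx k
    induction hx using Submodule.span_induction with
    | mem x hx =>
      obtain ⟨⟨ε, l⟩, rfl⟩ := hx
      dsimp only
      rw [mul_assoc]
      by_cases h : Even k ↔ Even l
      · rw [letter_congr h, ← word_add_one hγ]
        exact hV _ _
      · rw [letter_congr (l := l - 1) (by rw [Int.even_sub_one]; tauto), ← word_sub_one hγ]
        exact hV _ _
    | zero => simp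
    | add x y _ _ h h' => rw [add_mul]; exact V.add_mem h h'
    | smul c x _ h => rw [smul_mul_assoc]; exact V.smul_mem c h
  have hi : ∀ x ∈ V, ∀ ε, idem G ε * x ∈ V := by
    intro x hx ε
    induction hx using Submodule.span_induction with
    | mem x hx =>
      obtain ⟨⟨ε', l⟩, rfl⟩ := hx
      dsimp only
      rw [← mul_assoc, idem_mul_idem]
      split_ifs
      · exact hV _ _
      · simp
    | zero => simp
    | add x y _ _ h h' => rw [mul_add]; exact V.add_mem h h'
    | smul c x _ h => rw [mul_smul_comm]; exact V.smul_mem c h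
  refine eq_top_iff.2 fun x hx => ?_
  clear hx
  suffices h : ∀ y ∈ V, y * x ∈ V by
    rw [← one_mul x, ← idem_add]
    refine h _ (V.add_mem ?_ ?_)
    · simpa [word_zero] using hV true 0
    · simpa [word_zero] using hV false 0
  induction x using induction with
  | hc c =>
    intro y hy
    rw [← Algebra.commutes, ← Algebra.smul_def]
    exact V.smul_mem c hy
  | ha i j g =>
    intro y hy
    rcases hG g with rfl | rfl
    · have : (a i j 1 : WreathAlg 2 G) = idem G (decide (i = j)) := by
        rw [idem_eq _ i]; fin_cases i <;> fin_cases j <;> simp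
      rw [this, ← idem_comm]
      exact hi y hy _
    · have : (a i j g : WreathAlg 2 G) =
          idem G (decide (i = j)) * letter g (i : ℕ) := by
        rw [idem_mul_letter]; fin_cases i <;> fin_cases j <;> simp
      rw [this, ← mul_assoc, ← idem_comm]
      exact hl _ (hi y hy _) _
  | hadd x y h h' => intro z hz; rw [mul_add]; exact V.add_mem (h z hz) (h' z hz)
  | hmul x y h h' => intro z hz; rw [← mul_assoc]; exact h' _ (h z hz)

/-! ### The coalgebra structure of `𝒜₂(ℤ/2)` -/

lemma comulHom_idem (ε : Bool) :
    comulHom (idem G ε) = idem G true ⊗ₜ[ℂ] idem G ε + idem G false ⊗ₜ[ℂ] idem G (!ε) := by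
  cases ε
  · rw [idem_false, comulHom_a, Fin.sum_univ_two, ← idem_true, ← idem_false, ← idem_true']
    rfl
  · rw [idem_true, comulHom_a, Fin.sum_univ_two, ← idem_true, ← idem_false, ← idem_false']
    rfl

lemma comulHom_letter (k : ℤ) :
    comulHom (letter γ k) = (idem G true * letter γ k) ⊗ₜ[ℂ] letter γ k +
      (idem G false * letter γ k) ⊗ₜ[ℂ] letter γ (k + 1) := by
  simp only [idem_mul_letter]
  by_cases h : Even k
  · have h' : ¬ Even (k + 1) := by simpa [Int.even_add_one] using h
    simp [letter, h, h', TensorProduct.tmul_add, Fin.sum_univ_two]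
    abel
  · have h' : Even (k + 1) := by simpa [Int.even_add_one] using h
    simp [letter, h, h', TensorProduct.tmul_add, Fin.sum_univ_two]
    abel

lemma comulHom_word (hγ : γ * γ = 1) (k : ℤ) :
    comulHom (word γ k) = (idem G true * word γ k) ⊗ₜ[ℂ] word γ k +
      (idem G false * word γ k) ⊗ₜ[ℂ] word γ (-k) := by
  have key : ∀ (ε : Bool) (x y : WreathAlg 2 G),
      idem G ε * x * (idem G ε * y) = idem G ε * (x * y) := by
    intro ε x y
    rw [← mul_assoc, mul_assoc (idem G ε) x, ← idem_comm, ← mul_assoc, idem_mul_idem, if_pos rfl,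
      mul_assoc]
  have key' : ∀ (ε : Bool) (x y : WreathAlg 2 G),
      idem G ε * x * (idem G (!ε) * y) = 0 := by
    intro ε x y
    rw [← mul_assoc, mul_assoc (idem G ε) x, ← idem_comm, ← mul_assoc, idem_mul_idem]
    simp
  have k1 := fun x y => key' true x y
  have k2 := fun x y => key' false x y
  simp only [Bool.not_true, Bool.not_false] at k1 k2
  induction k using Int.induction_on with
  | zero =>
    simp [word_zero, ← TensorProduct.add_tmul, idem_add, Algebra.TensorProduct.one_def]
  | succ i ih =>
    have e : -((i : ℤ) + 1) = -i - 1 := by ring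
    rw [word_add_one hγ, map_mul, ih, comulHom_letter, e, word_sub_one hγ,
      letter_congr (k := (i : ℤ) + 1) (l := -i - 1) (by grind)]
    simp only [add_mul, mul_add, Algebra.TensorProduct.tmul_mul_tmul, key, k1, k2]
    simp
  | pred i ih =>
    have e : -(-(i : ℤ) - 1) = i + 1 := by ring
    rw [word_sub_one hγ, map_mul, ih, comulHom_letter, e, word_add_one hγ,
      letter_congr (k := -(i : ℤ) - 1 + 1) (l := i) (by simp), neg_neg]
    simp only [add_mul, mul_add, Algebra.TensorProduct.tmul_mul_tmul, key, k1, k2]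
    simp

/-- The coproduct of `p_ε w` is that of the function `z ^ k` on a component of `O(2)`. -/
lemma comulHom_idem_mul_word (hγ : γ * γ = 1) (ε : Bool) (k : ℤ) :
    comulHom (idem G ε * word γ k) =
      (idem G true * word γ k) ⊗ₜ[ℂ] (idem G ε * word γ k) +
        (idem G false * word γ k) ⊗ₜ[ℂ] (idem G (!ε) * word γ (-k)) := by
  rw [map_mul, comulHom_idem, comulHom_word hγ]
  simp only [add_mul, mul_add, Algebra.TensorProduct.tmul_mul_tmul, ← mul_assoc, idem_mul_idem]
  simp

lemma counitHom_idem (ε : Bool) : counitHom (idem G ε) = if ε then 1 else 0 := by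
  cases ε <;> simp [idem]

lemma counitHom_word (hγ : γ * γ = 1) (k : ℤ) : counitHom (word γ k) = 1 := by
  have hl : ∀ l, counitHom (letter γ l) = 1 := by
    intro l
    by_cases h : Even l <;> simp [letter, h]
  induction k using Int.induction_on with
  | zero => simp [word_zero]
  | succ i ih => rw [word_add_one hγ, map_mul, ih, hl, one_mul]
  | pred i ih => rw [word_sub_one hγ, map_mul, ih, hl, one_mul]

end WreathAlg

/-! ### The orthogonal group `O(2)` -/

/-- The compact group `O(2)`. -/
abbrev O2 : Type := Matrix.orthogonalGroup (Fin 2) ℝ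

namespace O2

/-- The rotation by the complex number `w` of modulus one. -/
def rot : Circle →* O2 where
  toFun w := ⟨!![(w : ℂ).re, -(w : ℂ).im; (w : ℂ).im, (w : ℂ).re], by
    have h := Complex.normSq_apply (w : ℂ)
    rw [Circle.normSq_coe] at h
    rw [Matrix.mem_orthogonalGroup_iff]
    ext i j
    fin_cases i <;> fin_cases j <;> simp [Matrix.mul_apply, Fin.sum_univ_two] <;> linarith⟩
  map_one' := by
    apply Subtype.ext
    ext i j
    fin_cases i <;> fin_cases j <;> simp
  map_mul' w w' := by
    apply Subtype.ext
    ext i j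
    fin_cases i <;> fin_cases j <;> simp <;> ring

/-- The reflection `diag(1, -1)`. -/
def refl : O2 := ⟨!![1, 0; 0, -1], by
  rw [Matrix.mem_orthogonalGroup_iff]
  ext i j
  fin_cases i <;> fin_cases j <;> simp [Matrix.mul_apply, Fin.sum_univ_two]⟩

lemma coe_rot (w : Circle) :
    (rot w : Matrix (Fin 2) (Fin 2) ℝ) =
      !![(w : ℂ).re, -(w : ℂ).im; (w : ℂ).im, (w : ℂ).re] := rfl

lemma coe_refl : (refl : Matrix (Fin 2) (Fin 2) ℝ) = !![1, 0; 0, -1] := rfl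

lemma coe_rot_mul_refl (w : Circle) :
    ((rot w * refl : O2) : Matrix (Fin 2) (Fin 2) ℝ) =
      !![(w : ℂ).re, (w : ℂ).im; (w : ℂ).im, -(w : ℂ).re] := by
  ext i j
  fin_cases i <;> fin_cases j <;>
    simp [coe_rot, coe_refl, Matrix.mul_apply, Fin.sum_univ_two]

@[simp]
lemma refl_mul_refl : refl * refl = 1 := by
  apply Subtype.ext
  ext i j
  fin_cases i <;> fin_cases j <;> simp [coe_refl, Matrix.mul_apply, Fin.sum_univ_two]

lemma refl_mul_rot (w : Circle) : refl * rot w = rot w⁻¹ * refl := by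
  apply Subtype.ext
  ext i j
  fin_cases i <;> fin_cases j <;>
    simp [coe_refl, coe_rot, Matrix.mul_apply, Fin.sum_univ_two]

lemma continuous_rot : Continuous rot := by
  refine Continuous.subtype_mk (continuous_pi fun i => continuous_pi fun j => ?_) _
  have h1 : Continuous fun w : Circle => (w : ℂ).re :=
    Complex.continuous_re.comp continuous_subtype_val
  have h2 : Continuous fun w : Circle => (w : ℂ).im :=
    Complex.continuous_im.comp continuous_subtype_val
  fin_cases i <;> fin_cases j
  exacts [h1, h2.neg, h2, h1]

/-- The first column of an orthogonal matrix, as a complex number. -/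
def firstCol (M : O2) : ℂ := ⟨M.1 0 0, M.1 1 0⟩

lemma normSq_firstCol (M : O2) : Complex.normSq (firstCol M) = 1 := by
  have h := congrFun (congrFun ((Matrix.mem_orthogonalGroup_iff' _ _).1 M.2) 0) 0
  simpa [Matrix.mul_apply, Fin.sum_univ_two, firstCol, Complex.normSq_apply] using h

/-- Every orthogonal matrix is a rotation or the product of a rotation and `refl`. -/
lemma exists_rot (M : O2) : ∃ w : Circle, M = rot w ∨ M = rot w * refl := by
  obtain ⟨M, hM⟩ := M
  have h := normSq_firstCol ⟨M, hM⟩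
  have hw : firstCol ⟨M, hM⟩ ∈ Submonoid.unitSphere ℂ := by
    refine mem_sphere_zero_iff_norm.2 ?_
    rw [← sq_eq_sq₀ (norm_nonneg _) zero_le_one,
      ← Complex.normSq_eq_norm_sq, h, one_pow]
  refine ⟨⟨firstCol ⟨M, hM⟩, hw⟩, ?_⟩
  have hc := (Matrix.mem_orthogonalGroup_iff' _ _).1 hM
  have h00 := congrFun (congrFun hc 0) 0
  have h01 := congrFun (congrFun hc 0) 1
  have h11 := congrFun (congrFun hc 1) 1
  simp only [Matrix.mul_apply, Fin.sum_univ_two, Matrix.transpose_apply, Matrix.one_apply_eq,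
    Matrix.one_apply_ne (show (0 : Fin 2) ≠ 1 by simp)] at h00 h01 h11
  set A := M 0 0
  set B := M 0 1
  set C := M 1 0
  set D := M 1 1
  have hd : (A * D - B * C) * (A * D - B * C) = 1 := by
    linear_combination (B * B + D * D) * h00 + h11 - (A * B + C * D) * h01
  rcases mul_self_eq_one_iff.1 hd with hd | hd
  · left
    have e1 : B = -C := by linear_combination (-B) * h00 + A * h01 - C * hd
    have e2 : D = A := by linear_combination (-D) * h00 + C * h01 + A * hd
    apply Subtype.ext
    ext i j
    fin_cases i <;> fin_cases j
    exacts [rfl, e1, rfl, e2]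
  · right
    have e1 : B = C := by linear_combination (-B) * h00 + A * h01 - C * hd
    have e2 : D = -A := by linear_combination (-D) * h00 + C * h01 + A * hd
    apply Subtype.ext
    refine Eq.trans ?_ (coe_rot_mul_refl _).symm
    ext i j
    fin_cases i <;> fin_cases j
    exacts [rfl, e1, rfl, e2]

lemma firstCol_rot (w : Circle) : firstCol (rot w) = w := by
  simp [firstCol, coe_rot]

lemma firstCol_rot_mul_refl (w : Circle) : firstCol (rot w * refl) = w := by
  simp [firstCol, coe_rot, coe_refl, Matrix.mul_apply, Fin.sum_univ_two]

/-! ### Trigonometric functions on `O(2)` -/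

/-- The continuous function `M ↦ z(M) ^ k`, where `z(M)` is the first column of `M`. -/
def zpow (k : ℤ) : C(O2, ℂ) where
  toFun M := firstCol M ^ k
  continuous_toFun := by
    have h0 : ∀ M, firstCol M ≠ 0 := fun M h => by
      simpa [h] using normSq_firstCol M
    have h1 : Continuous firstCol := by
      have e : firstCol = fun M : O2 => (M.1 0 0 : ℂ) + (M.1 1 0 : ℂ) * Complex.I := by
        funext M
        exact Complex.mk_eq_add_mul_I _ _
      have h2 : ∀ i j, Continuous fun M : O2 => (M.1 i j : ℂ) := fun i j =>
        Complex.continuous_ofReal.comp (continuous_subtype_val.matrix_elem i j)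
      rw [e]
      exact (h2 0 0).add ((h2 1 0).mul continuous_const)
    exact h1.zpow₀ k fun M => Or.inl (h0 M)

/-- The indicator function of the component of `O(2)` of the matrices with determinant `1`
(`ε = true`) or `-1` (`ε = false`). -/
def ind (ε : Bool) : C(O2, ℂ) where
  toFun M := (1 + (if ε then 1 else -1) * (M.1.det : ℂ)) / 2
  continuous_toFun := by
    have : Continuous fun M : O2 => M.1.det := continuous_subtype_val.matrix_det
    fun_prop

@[simp]
lemma zpow_rot (k : ℤ) (w : Circle) : zpow k (rot w) = (w : ℂ) ^ k := by
  simp [zpow, firstCol_rot]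

@[simp]
lemma zpow_rot_mul_refl (k : ℤ) (w : Circle) : zpow k (rot w * refl) = (w : ℂ) ^ k := by
  simp [zpow, firstCol_rot_mul_refl]

lemma det_rot (w : Circle) : (rot w : Matrix (Fin 2) (Fin 2) ℝ).det = 1 := by
  have h := Complex.normSq_apply (w : ℂ)
  rw [Circle.normSq_coe] at h
  rw [coe_rot, Matrix.det_fin_two_of]
  linarith

lemma det_refl : (refl : Matrix (Fin 2) (Fin 2) ℝ).det = -1 := by
  simp [coe_refl, Matrix.det_fin_two_of]

@[simp]
lemma ind_rot (ε : Bool) (w : Circle) : ind ε (rot w) = if ε then 1 else 0 := by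
  cases ε <;> simp [ind, det_rot]

@[simp]
lemma ind_rot_mul_refl (ε : Bool) (w : Circle) : ind ε (rot w * refl) = if ε then 0 else 1 := by
  cases ε <;> simp [ind, det_rot, det_refl]

lemma refl_mul_rot_mul_refl (w : Circle) : refl * rot w * refl = rot w⁻¹ := by
  rw [refl_mul_rot, mul_assoc, refl_mul_refl, mul_one]

/-- The algebra automorphism of `C(O(2), ℂ)` induced by conjugation with `refl`. -/
def conjRefl : C(O2, ℂ) →ₐ[ℂ] C(O2, ℂ) :=
  ContinuousMap.compRightAlgHom ℂ ℂ ⟨fun M : O2 => refl * M * refl, by fun_prop⟩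

lemma conjRefl_apply (f : C(O2, ℂ)) (M : O2) : conjRefl f M = f (refl * M * refl) := rfl

@[simp]
lemma conjRefl_conjRefl (f : C(O2, ℂ)) : conjRefl (conjRefl f) = f := by
  ext M
  simp only [conjRefl_apply]
  congr 1
  calc refl * (refl * M * refl) * refl = (refl * refl) * M * (refl * refl) := by group
    _ = M := by simp

/-- Two continuous functions on `O(2)` are equal if they agree on rotations and on reflections. -/
lemma ext_rot {f f' : C(O2, ℂ)} (h : ∀ w, f (rot w) = f' (rot w))
    (h' : ∀ w, f (rot w * refl) = f' (rot w * refl)) : f = f' := by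
  ext M
  obtain ⟨w, rfl | rfl⟩ := exists_rot M
  · exact h w
  · exact h' w

@[simp]
lemma conjRefl_rot (f : C(O2, ℂ)) (w : Circle) : conjRefl f (rot w) = f (rot w⁻¹) := by
  rw [conjRefl_apply, refl_mul_rot_mul_refl]

@[simp]
lemma conjRefl_rot_mul_refl (f : C(O2, ℂ)) (w : Circle) :
    conjRefl f (rot w * refl) = f (rot w⁻¹ * refl) := by
  rw [conjRefl_apply, ← mul_assoc, refl_mul_rot_mul_refl]

@[simp]
lemma conjRefl_ind (ε : Bool) : conjRefl (ind ε) = ind ε :=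
  ext_rot (by simp [-map_inv]) (by simp [-map_inv])

@[simp]
lemma conjRefl_zpow (k : ℤ) : conjRefl (zpow k) = zpow (-k) :=
  ext_rot (by simp [-map_inv]) (by simp [-map_inv])

lemma zpow_mul_zpow (k l : ℤ) : zpow k * zpow l = zpow (k + l) :=
  ext_rot (fun w => by simp [zpow_add₀]) (fun w => by simp [zpow_add₀])

lemma zpow_zero : zpow 0 = 1 := ext_rot (by simp) (by simp)

lemma ind_mul_ind (ε ε' : Bool) : ind ε * ind ε' = if ε = ε' then ind ε else 0 := by
  cases ε <;> cases ε' <;> refine ext_rot (fun w => ?_) (fun w => ?_) <;> simp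

lemma ind_add : ind true + ind false = 1 := ext_rot (by simp) (by simp)

/-- The comultiplication of the function ring of `O(2)`. -/
lemma ind_mul_zpow_apply_mul (ε : Bool) (k : ℤ) (g h : O2) :
    (ind ε * zpow k) (g * h) = (ind true * zpow k) g * (ind ε * zpow k) h +
      (ind false * zpow k) g * (ind (!ε) * zpow (-k)) h := by
  obtain ⟨w, rfl | rfl⟩ := exists_rot g <;> obtain ⟨w', rfl | rfl⟩ := exists_rot h
  · rw [← map_mul]
    cases ε <;> simp [mul_zpow, -map_mul, -map_inv]
  · rw [← mul_assoc, ← map_mul]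
    cases ε <;> simp [mul_zpow, -map_mul, -map_inv]
  · rw [mul_assoc, refl_mul_rot, ← mul_assoc, ← map_mul]
    cases ε <;> simp [mul_zpow, -map_mul, -map_inv]
  · rw [mul_assoc, ← mul_assoc refl, refl_mul_rot_mul_refl, ← map_mul]
    cases ε <;> simp [mul_zpow, -map_mul, -map_inv]

end O2

/-! ### The action of `𝒜₂(ℤ/2)` on functions on `O(2)` -/

namespace WreathAlg

open O2

variable {G : Type*} [Group G] {γ : G}

lemma mul_self_eq_one (hγ : γ ≠ 1) (hG : ∀ g : G, g = 1 ∨ g = γ) : γ * γ = 1 :=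
  (hG _).resolve_right fun h => hγ (mul_eq_left.1 h)

open Classical in
/-- The operator by which the generator `a_{ij}(g)` acts on functions on `O(2)`: the idempotents
act by multiplication with the indicator functions of the components, and the involutions `s` and
`t` by `f ↦ z ^ (±1) f(refl · refl)`. -/
def genOp (i j : Fin 2) (g : G) : Module.End ℂ C(O2, ℂ) :=
  LinearMap.mulLeft ℂ (ind (decide (i = j))) *
    if g = 1 then 1 else LinearMap.mulLeft ℂ (zpow (if i = 0 then 1 else -1)) *
      conjRefl.toLinearMap

lemma genOp_one (i j : Fin 2) (f : C(O2, ℂ)) :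
    genOp i j (1 : G) f = ind (decide (i = j)) * f := by
  simp [genOp]

lemma genOp_of_ne (i j : Fin 2) {g : G} (hg : g ≠ 1) (f : C(O2, ℂ)) :
    genOp i j g f = ind (decide (i = j)) * (zpow (if i = 0 then 1 else -1) * conjRefl f) := by
  simp [genOp, hg]

lemma genOp_mul_genOp (hγ : γ ≠ 1) (hG : ∀ g : G, g = 1 ∨ g = γ) (i j k l : Fin 2) (g h : G)
    (hik : i = k ∨ j = l) :
    genOp i j g * genOp k l h =
      if i = k ∧ j = l then genOp i j (g * h) else 0 := by
  have hi : ∀ f : C(O2, ℂ),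
      ind (decide (i = j)) * (ind (decide (k = l)) * f) =
        if i = k ∧ j = l then ind (decide (i = j)) * f else 0 := by
    intro f
    rw [← mul_assoc, ind_mul_ind]
    revert hik
    fin_cases i <;> fin_cases j <;> fin_cases k <;> fin_cases l <;> simp
  have hz : ∀ n : ℤ, ∀ f, zpow n * (zpow (-n) * f) = f := by
    intro n f
    rw [← mul_assoc, zpow_mul_zpow, add_neg_cancel, zpow_zero, one_mul]
  refine LinearMap.ext fun f => ?_
  rw [Module.End.mul_apply]
  by_cases hc : i = k ∧ j = l
  · obtain ⟨rfl, rfl⟩ := hc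
    simp only [and_self, if_true] at hi ⊢
    rcases hG g with rfl | rfl <;> rcases hG h with rfl | rfl
    · rw [genOp_one, genOp_one, hi, one_mul, genOp_one]
    · rw [genOp_one, genOp_of_ne _ _ hγ, hi, one_mul, genOp_of_ne _ _ hγ]
    · rw [genOp_one, genOp_of_ne _ _ hγ, map_mul, conjRefl_ind, mul_left_comm (zpow _), hi,
        mul_one, genOp_of_ne _ _ hγ]
    · rw [genOp_of_ne _ _ hγ, genOp_of_ne _ _ hγ, map_mul, conjRefl_ind, map_mul, conjRefl_zpow,
        conjRefl_conjRefl, mul_left_comm (zpow _), hi, hz, mul_self_eq_one hγ hG, genOp_one]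
  · simp only [if_neg hc] at hi ⊢
    rw [LinearMap.zero_apply]
    rcases hG g with rfl | rfl <;> rcases hG h with rfl | rfl
    · rw [genOp_one, genOp_one, hi]
    · rw [genOp_one, genOp_of_ne _ _ hγ, hi]
    · rw [genOp_one, genOp_of_ne _ _ hγ, map_mul, conjRefl_ind, mul_left_comm (zpow _), hi]
    · rw [genOp_of_ne _ _ hγ, genOp_of_ne _ _ hγ, map_mul, conjRefl_ind, mul_left_comm (zpow _), hi]

/-- The action of `𝒜₂(G)` on the continuous functions on `O(2)`, for a group `G = {1, γ}`. -/
def act (hγ : γ ≠ 1) (hG : ∀ g : G, g = 1 ∨ g = γ) :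
    WreathAlg 2 G →ₐ[ℂ] Module.End ℂ C(O2, ℂ) :=
  lift genOp
    (fun i j k g h => by simp [genOp_mul_genOp hγ hG i j i k g h (Or.inl rfl)])
    (fun i j k g h => by simp [genOp_mul_genOp hγ hG j i k i g h (Or.inr rfl)])
    (fun i => by
      refine LinearMap.ext fun f => ?_
      have h := ind_add
      fin_cases i <;> simp [Fin.sum_univ_two, genOp_one, ← add_mul, h]
      rw [add_comm, h, one_mul])
    (fun i => by
      refine LinearMap.ext fun f => ?_
      have h := ind_add
      fin_cases i <;> simp [Fin.sum_univ_two, genOp_one, ← add_mul, h]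
      rw [add_comm, h, one_mul])

variable (hγ : γ ≠ 1) (hG : ∀ g : G, g = 1 ∨ g = γ)

lemma act_idem (ε : Bool) (f : C(O2, ℂ)) : act hγ hG (idem G ε) f = ind ε * f := by
  cases ε <;> simp [idem, act, genOp_one]

lemma act_letter (k : ℤ) (f : C(O2, ℂ)) :
    act hγ hG (letter γ k) f = zpow (if Even k then 1 else -1) * conjRefl f := by
  have h := ind_add
  by_cases hk : Even k
  · simp [letter, hk, act, genOp_of_ne _ _ hγ, ← add_mul, h]
  · simp [letter, hk, act, genOp_of_ne _ _ hγ, ← add_mul]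
    rw [add_comm, h, one_mul]

lemma act_word (k : ℤ) (f : C(O2, ℂ)) :
    act hγ hG (word γ k) f = zpow k * if Even k then f else conjRefl f := by
  have hγ' := mul_self_eq_one hγ hG
  induction k using Int.induction_on generalizing f with
  | zero => simp [word_zero, zpow_zero]
  | succ i ih =>
    rw [word_add_one hγ', map_mul, Module.End.mul_apply, act_letter, ih]
    by_cases h : Even (i : ℤ)
    · rw [if_pos h, if_pos h, if_neg (by simpa [Int.even_add_one] using h), ← mul_assoc,
        zpow_mul_zpow]
    · rw [if_neg h, if_neg h, if_pos (by simpa [Int.even_add_one] using h), map_mul,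
        conjRefl_zpow, conjRefl_conjRefl, ← mul_assoc, zpow_mul_zpow, neg_neg]
  | pred i ih =>
    rw [word_sub_one hγ', map_mul, Module.End.mul_apply, act_letter, ih]
    by_cases h : Even (-(i : ℤ))
    · have h' : ¬ Even (-(i : ℤ) - 1) := by rw [Int.even_sub_one]; exact not_not.2 h
      rw [if_pos h, if_neg h', if_neg h', ← mul_assoc, zpow_mul_zpow, sub_eq_add_neg]
    · have h' : Even (-(i : ℤ) - 1) := by rw [Int.even_sub_one]; exact h
      rw [if_neg h, if_pos h', if_pos h', map_mul, conjRefl_zpow, conjRefl_conjRefl, ← mul_assoc,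
        zpow_mul_zpow, sub_eq_add_neg]

/-- The action commutes with multiplication by functions that are invariant under conjugation
with `refl`. -/
lemma act_mul (x : WreathAlg 2 G) {f : C(O2, ℂ)} (hf : conjRefl f = f) (f' : C(O2, ℂ)) :
    act hγ hG x (f * f') = f * act hγ hG x f' := by
  induction x using induction generalizing f' with
  | hc c => simp [Module.algebraMap_end_apply, mul_smul_comm]
  | ha i j g =>
    rcases hG g with rfl | rfl
    · simp [act, genOp_one, mul_left_comm]
    · simp only [act, lift_a, genOp_of_ne _ _ hγ, map_mul, hf]
      ring
  | hadd x y h h' => simp [h, h', mul_add]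
  | hmul x y h h' =>
    rw [map_mul (act hγ hG), Module.End.mul_apply, h', h, Module.End.mul_apply]

/-- The linear map `𝒜₂(ℤ/2) → C(O(2), ℂ)`, `x ↦ x · 1`. It is an isomorphism of coalgebras onto
the ring of trigonometric polynomials on `O(2)`, though not multiplicative. -/
def toO2 : WreathAlg 2 G →ₗ[ℂ] C(O2, ℂ) :=
  (LinearMap.applyₗ (1 : C(O2, ℂ))).comp (act hγ hG).toLinearMap

lemma toO2_apply (x : WreathAlg 2 G) : toO2 hγ hG x = act hγ hG x 1 := rfl

lemma toO2_idem_mul_word (ε : Bool) (k : ℤ) :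
    toO2 hγ hG (idem G ε * word γ k) = ind ε * zpow k := by
  rw [toO2_apply, map_mul, Module.End.mul_apply, act_word, act_idem]
  simp

/-- `toO2` is multiplicative as soon as the image of the second factor is invariant under
conjugation with `refl`. -/
lemma toO2_mul (x y : WreathAlg 2 G) (h : conjRefl (toO2 hγ hG y) = toO2 hγ hG y) :
    toO2 hγ hG (x * y) = toO2 hγ hG x * toO2 hγ hG y := by
  rw [toO2_apply, map_mul, Module.End.mul_apply, ← toO2_apply hγ hG y,
    ← mul_one (toO2 hγ hG y), act_mul hγ hG x h, ← toO2_apply, mul_one, mul_comm]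

/-- The value of `x ⊗ y` at `(g, h) ∈ O(2) × O(2)`. -/
def evalTensor (g h : O2) : WreathAlg 2 G ⊗[ℂ] WreathAlg 2 G →ₗ[ℂ] ℂ :=
  LinearMap.mul' ℂ ℂ ∘ₗ TensorProduct.map
    ((ContinuousMap.evalCLM ℂ g).toLinearMap ∘ₗ toO2 hγ hG)
    ((ContinuousMap.evalCLM ℂ h).toLinearMap ∘ₗ toO2 hγ hG)

lemma evalTensor_tmul (g h : O2) (x y : WreathAlg 2 G) :
    evalTensor hγ hG g h (x ⊗ₜ y) = toO2 hγ hG x g * toO2 hγ hG y h := by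
  simp [evalTensor]

/-- `toO2` is a homomorphism of coalgebras. -/
lemma toO2_apply_mul (x : WreathAlg 2 G) (g h : O2) :
    toO2 hγ hG x (g * h) = evalTensor hγ hG g h (comulHom x) := by
  have hγ' := mul_self_eq_one hγ hG
  have : (ContinuousMap.evalCLM ℂ (g * h)).toLinearMap ∘ₗ toO2 hγ hG =
      evalTensor hγ hG g h ∘ₗ comulHom.toLinearMap := by
    refine LinearMap.ext_on_range (span_idem_mul_word hγ' hG) fun ⟨ε, k⟩ => ?_
    simpa [toO2_idem_mul_word, comulHom_idem_mul_word hγ', evalTensor_tmul] using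
      ind_mul_zpow_apply_mul ε k g h
  exact LinearMap.congr_fun this x

lemma toO2_apply_one (x : WreathAlg 2 G) : toO2 hγ hG x 1 = counitHom x := by
  have hγ' := mul_self_eq_one hγ hG
  have : (ContinuousMap.evalCLM ℂ (1 : O2)).toLinearMap ∘ₗ toO2 hγ hG =
      counitHom.toLinearMap := by
    refine LinearMap.ext_on_range (span_idem_mul_word hγ' hG) fun ⟨ε, k⟩ => ?_
    have h1 := ind_rot ε 1
    have h2 := zpow_rot k 1
    rw [map_one] at h1 h2
    simp [toO2_idem_mul_word, counitHom_idem, counitHom_word hγ', h1, h2]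
  exact LinearMap.congr_fun this x

end WreathAlg

/-! ### Idempotent matrices -/

/-- `A` and `B` are mutually inverse isomorphisms between the images of the idempotent matrices
`E` and `E'`, extended by zero. -/
structure IsIdemIso {m n : Type*} [Fintype m] [Fintype n] (E : Matrix m m ℂ) (E' : Matrix n n ℂ)
    (A : Matrix n m ℂ) (B : Matrix m n ℂ) : Prop where
  inv_mul : B * A = E
  mul_inv : A * B = E'
  idem_mul : E' * A = A
  mul_idem : A * E = A
  idem_mul_inv : E * B = B
  inv_mul_idem : B * E' = B

lemma trace_eq_finrank_range {m : Type*} [Fintype m] [DecidableEq m] {E : Matrix m m ℂ}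
    (h : E * E = E) : E.trace = Module.finrank ℂ (LinearMap.range (Matrix.toLin' E)) := by
  have hp := (LinearMap.isProj_range_iff_isIdempotentElem (Matrix.toLin' E)).2 (by
    rw [IsIdempotentElem, Module.End.mul_eq_comp, ← Matrix.toLin'_mul, h])
  rw [← Matrix.trace_toLin'_eq, hp.trace]

/-- Idempotent complex matrices with the same trace have isomorphic images, since the trace of
an idempotent matrix is its rank. -/
lemma exists_isIdemIso {m n : Type*} [Fintype m] [DecidableEq m] [Fintype n] [DecidableEq n]
    {E : Matrix m m ℂ} {E' : Matrix n n ℂ} (h : E * E = E) (h' : E' * E' = E')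
    (ht : E.trace = E'.trace) : ∃ A B, IsIdemIso E E' A B := by
  set f := Matrix.toLin' E with hf
  set f' := Matrix.toLin' E' with hf'
  rw [trace_eq_finrank_range h, trace_eq_finrank_range h', Nat.cast_inj] at ht
  obtain ⟨e⟩ : Nonempty (LinearMap.range f ≃ₗ[ℂ] LinearMap.range f') :=
    FiniteDimensional.nonempty_linearEquiv_of_finrank_eq ht
  have hff : ∀ x : LinearMap.range f, f.rangeRestrict x = x := by
    rintro ⟨_, x, rfl⟩
    apply Subtype.ext
    simp [hf, Matrix.mulVec_mulVec, h]
  have hff' : ∀ x : LinearMap.range f', f'.rangeRestrict x = x := by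
    rintro ⟨_, x, rfl⟩
    apply Subtype.ext
    simp [hf', Matrix.mulVec_mulVec, h']
  have hE : E = LinearMap.toMatrix' f := (LinearMap.toMatrix'_toLin' E).symm
  have hE' : E' = LinearMap.toMatrix' f' := (LinearMap.toMatrix'_toLin' E').symm
  refine ⟨LinearMap.toMatrix' ((LinearMap.range f').subtype ∘ₗ e.toLinearMap ∘ₗ f.rangeRestrict),
    LinearMap.toMatrix' ((LinearMap.range f).subtype ∘ₗ e.symm.toLinearMap ∘ₗ f'.rangeRestrict),
    ?_, ?_, ?_, ?_, ?_, ?_⟩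
  · refine (LinearMap.toMatrix'_comp _ _).symm.trans (Eq.trans (congrArg _ ?_) hE.symm)
    exact LinearMap.ext fun x => by simp [hff']
  · refine (LinearMap.toMatrix'_comp _ _).symm.trans (Eq.trans (congrArg _ ?_) hE'.symm)
    exact LinearMap.ext fun x => by simp [hff]
  · rw [hE', ← LinearMap.toMatrix'_comp]
    refine congrArg _ (LinearMap.ext fun x => ?_)
    exact congrArg Subtype.val (hff' (e (f.rangeRestrict x)))
  · rw [hE, ← LinearMap.toMatrix'_comp]
    refine congrArg _ (LinearMap.ext fun x => ?_)
    exact congrArg (fun y => (e y : n → ℂ)) (hff (f.rangeRestrict x))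
  · rw [hE, ← LinearMap.toMatrix'_comp]
    refine congrArg _ (LinearMap.ext fun x => ?_)
    exact congrArg Subtype.val (hff (e.symm (f'.rangeRestrict x)))
  · rw [hE', ← LinearMap.toMatrix'_comp]
    refine congrArg _ (LinearMap.ext fun x => ?_)
    exact congrArg (fun y => (e.symm y : m → ℂ)) (hff' (f'.rangeRestrict x))

/-- The isomorphisms of the images of two orthogonal pairs of idempotents add up. -/
lemma IsIdemIso.add {m n : Type*} [Fintype m] [Fintype n] {E F : Matrix m m ℂ}
    {E' F' : Matrix n n ℂ} {A A' : Matrix n m ℂ} {B B' : Matrix m n ℂ}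
    (h : IsIdemIso E E' A B) (h' : IsIdemIso F F' A' B') (h1 : E * F = 0) (h2 : F * E = 0)
    (h3 : E' * F' = 0) (h4 : F' * E' = 0) : IsIdemIso (E + F) (E' + F') (A + A') (B + B') := by
  have a1 : B * A' = 0 := by
    rw [← h.inv_mul_idem, ← h'.idem_mul, Matrix.mul_assoc, ← Matrix.mul_assoc E', h3]; simp
  have a2 : B' * A = 0 := by
    rw [← h'.inv_mul_idem, ← h.idem_mul, Matrix.mul_assoc, ← Matrix.mul_assoc F', h4]; simp
  have a3 : A * B' = 0 := by
    rw [← h.mul_idem, ← h'.idem_mul_inv, Matrix.mul_assoc, ← Matrix.mul_assoc E, h1]; simp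
  have a4 : A' * B = 0 := by
    rw [← h'.mul_idem, ← h.idem_mul_inv, Matrix.mul_assoc, ← Matrix.mul_assoc F, h2]; simp
  have a5 : E' * A' = 0 := by rw [← h'.idem_mul, ← Matrix.mul_assoc, h3]; simp
  have a6 : F' * A = 0 := by rw [← h.idem_mul, ← Matrix.mul_assoc, h4]; simp
  have a7 : A * F = 0 := by rw [← h.mul_idem, Matrix.mul_assoc, h1]; simp
  have a8 : A' * E = 0 := by rw [← h'.mul_idem, Matrix.mul_assoc, h2]; simp
  have a9 : E * B' = 0 := by rw [← h'.idem_mul_inv, ← Matrix.mul_assoc, h1]; simp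
  have b1 : F * B = 0 := by rw [← h.idem_mul_inv, ← Matrix.mul_assoc, h2]; simp
  have b2 : B * F' = 0 := by rw [← h.inv_mul_idem, Matrix.mul_assoc, h3]; simp
  have b3 : B' * E' = 0 := by rw [← h'.inv_mul_idem, Matrix.mul_assoc, h4]; simp
  constructor <;> simp [Matrix.mul_add, Matrix.add_mul, *, h.inv_mul, h.mul_inv, h.idem_mul,
    h.mul_idem, h.idem_mul_inv, h.inv_mul_idem, h'.inv_mul, h'.mul_inv, h'.idem_mul,
    h'.mul_idem, h'.idem_mul_inv, h'.inv_mul_idem]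

lemma conj_mul_conj {k l r s t : Type*} [Fintype k] [Fintype l] [Fintype r] [DecidableEq r]
    {S : Matrix r r ℂ} (hS : S * S = 1) (X : Matrix s k ℂ) (Y : Matrix k r ℂ) (Z : Matrix r l ℂ)
    (W : Matrix l t ℂ) : (X * Y * S) * (S * Z * W) = X * (Y * Z) * W := by
  calc (X * Y * S) * (S * Z * W) = X * Y * (S * S) * Z * W := by simp only [Matrix.mul_assoc]
    _ = X * (Y * Z) * W := by rw [hS, Matrix.mul_one]; simp only [Matrix.mul_assoc]

/-- Isomorphisms of the images of idempotents can be conjugated with involutions. -/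
lemma IsIdemIso.conj {m n : Type*} [Fintype m] [Fintype n] [DecidableEq m] [DecidableEq n]
    {E : Matrix m m ℂ} {E' : Matrix n n ℂ} {A : Matrix n m ℂ} {B : Matrix m n ℂ}
    (h : IsIdemIso E E' A B) {R : Matrix m m ℂ} {R' : Matrix n n ℂ} (hR : R * R = 1)
    (hR' : R' * R' = 1) :
    IsIdemIso (R * E * R) (R' * E' * R') (R' * A * R) (R * B * R') := by
  constructor
  · rw [conj_mul_conj hR', h.inv_mul]
  · rw [conj_mul_conj hR, h.mul_inv]
  · rw [conj_mul_conj hR', h.idem_mul]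
  · rw [conj_mul_conj hR, h.mul_idem]
  · rw [conj_mul_conj hR, h.idem_mul_inv]
  · rw [conj_mul_conj hR', h.inv_mul_idem]

section Involution

variable {r : Type*} [Fintype r] [DecidableEq r] {Q S : Matrix r r ℂ}

lemma comm_of_conj_eq (h1 : S * S = 1) (h2 : S * Q * S = Q) : S * Q = Q * S := by
  calc S * Q = S * Q * (S * S) := by rw [h1, Matrix.mul_one]
    _ = Q * S := by rw [← Matrix.mul_assoc, h2]

lemma mul_add_smul_mul (a b : ℂ) (h1 : S * S = 1) (h2 : S * Q = Q * S) (h3 : Q * Q = Q) :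
    (Q + a • (Q * S)) * (Q + b • (Q * S)) = (1 + a * b) • Q + (a + b) • (Q * S) := by
  have e1 : Q * (Q * S) = Q * S := by rw [← Matrix.mul_assoc, h3]
  have e2 : Q * S * Q = Q * S := by rw [Matrix.mul_assoc, h2, e1]
  have e3 : Q * S * (Q * S) = Q := by
    rw [← Matrix.mul_assoc, e2, Matrix.mul_assoc, h1, Matrix.mul_one]
  simp only [Matrix.mul_add, Matrix.add_mul, Matrix.smul_mul, Matrix.mul_smul, e1, e2, e3, h3]
  module

lemma add_smul_mul_ortho {a b : ℂ} (h1 : a * b = -1) (h2 : a + b = 0) (h3 : S * S = 1)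
    (h4 : S * Q = Q * S) (h5 : Q * Q = Q) :
    ((2⁻¹ : ℂ) • (Q + a • (Q * S))) * ((2⁻¹ : ℂ) • (Q + b • (Q * S))) = 0 := by
  rw [Matrix.smul_mul, Matrix.mul_smul, mul_add_smul_mul a b h3 h4 h5, h1, h2]
  simp

end Involution

/-- Two orthogonal decompositions of the unit, indexed by `ℤ` and reversed by involutions `R`,
`R'`, are simultaneously similar if corresponding idempotents, and those cut out by `R`, `R'` from
the idempotents of index `0`, have the same traces. -/
lemma exists_intertwiner {m n : Type*} [Fintype m] [DecidableEq m] [Fintype n] [DecidableEq n]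
    {P : ℤ → Matrix m m ℂ} {P' : ℤ → Matrix n n ℂ} {R : Matrix m m ℂ} {R' : Matrix n n ℂ}
    (hP : ∀ k l, P k * P l = if k = l then P k else 0)
    (hP' : ∀ k l, P' k * P' l = if k = l then P' k else 0)
    (hR : R * R = 1) (hR' : R' * R' = 1)
    (hRP : ∀ k, R * P k * R = P (-k)) (hRP' : ∀ k, R' * P' k * R' = P' (-k))
    (ht : ∀ k, (P k).trace = (P' k).trace) (ht0 : (P 0 * R).trace = (P' 0 * R').trace)
    {N : ℕ} (hN : ∑ k ∈ Finset.Icc (-(N : ℤ)) N, P k = 1)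
    (hN' : ∑ k ∈ Finset.Icc (-(N : ℤ)) N, P' k = 1) :
    ∃ (T : Matrix n m ℂ) (S : Matrix m n ℂ), T * S = 1 ∧ S * T = 1 ∧ T * R = R' * T ∧
      ∀ k ∈ Finset.Icc (-(N : ℤ)) N, T * P k = P' k * T := by
  -- On the image of `P k`, for `k ≠ 0`, any isomorphism will do.
  have hk : ∀ k, ∃ A B, IsIdemIso (P k) (P' k) A B := fun k =>
    exists_isIdemIso (by simp [hP]) (by simp [hP']) (ht k)
  choose C D hCD using hk
  -- On the image of `P 0`, the isomorphism has to respect the eigenspaces of the involutions.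
  have h0 : ∃ A B, IsIdemIso (P 0) (P' 0) A B ∧ A * R = R' * A := by
    have c : R * P 0 = P 0 * R := comm_of_conj_eq hR (by simpa using hRP 0)
    have c' : R' * P' 0 = P' 0 * R' := comm_of_conj_eq hR' (by simpa using hRP' 0)
    have p0 : P 0 * P 0 = P 0 := by simp [hP]
    have p0' : P' 0 * P' 0 = P' 0 := by simp [hP']
    have half : ∀ a : ℂ, a * a = 1 → ∃ (A : Matrix n m ℂ) (B : Matrix m n ℂ),
        IsIdemIso ((2⁻¹ : ℂ) • (P 0 + a • (P 0 * R))) ((2⁻¹ : ℂ) • (P' 0 + a • (P' 0 * R'))) A B := by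
      intro a ha
      refine exists_isIdemIso ?_ ?_ ?_
      · rw [Matrix.smul_mul, Matrix.mul_smul, mul_add_smul_mul a a hR c p0, ha]
        module
      · rw [Matrix.smul_mul, Matrix.mul_smul, mul_add_smul_mul a a hR' c' p0', ha]
        module
      · simp [ht, ht0]
    obtain ⟨A1, B1, h1⟩ := half 1 (by norm_num)
    obtain ⟨A2, B2, h2⟩ := half (-1) (by norm_num)
    have hs := h1.add h2 (add_smul_mul_ortho (by norm_num) (by norm_num) hR c p0)
      (add_smul_mul_ortho (by norm_num) (by norm_num) hR c p0)
      (add_smul_mul_ortho (by norm_num) (by norm_num) hR' c' p0')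
      (add_smul_mul_ortho (by norm_num) (by norm_num) hR' c' p0')
    refine ⟨A1 + A2, B1 + B2, ?_, ?_⟩
    · convert hs using 1 <;> module
    · have eR : ∀ a : ℂ, a * a = 1 →
          ((2⁻¹ : ℂ) • (P 0 + a • (P 0 * R))) * R = a • (2⁻¹ : ℂ) • (P 0 + a • (P 0 * R)) := by
        intro a ha
        rw [Matrix.smul_mul, Matrix.add_mul, Matrix.smul_mul, Matrix.mul_assoc, hR, Matrix.mul_one,
          smul_comm a, smul_add a, smul_smul a a, ha, one_smul, add_comm]
      have eR' : ∀ a : ℂ, a * a = 1 →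
          R' * ((2⁻¹ : ℂ) • (P' 0 + a • (P' 0 * R'))) =
            a • (2⁻¹ : ℂ) • (P' 0 + a • (P' 0 * R')) := by
        intro a ha
        rw [Matrix.mul_smul, Matrix.mul_add, Matrix.mul_smul, ← Matrix.mul_assoc, c',
          Matrix.mul_assoc, hR', Matrix.mul_one,
          smul_comm a, smul_add a, smul_smul a a, ha, one_smul, add_comm]
      have f1 : A1 * R = A1 := by
        rw [← h1.mul_idem, Matrix.mul_assoc, eR 1 (by norm_num), one_smul]
      have f2 : A2 * R = -A2 := by
        rw [← h2.mul_idem, Matrix.mul_assoc, eR (-1) (by norm_num), neg_one_smul, Matrix.mul_neg]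
      have f3 : R' * A1 = A1 := by
        rw [← h1.idem_mul, ← Matrix.mul_assoc, eR' 1 (by norm_num), one_smul]
      have f4 : R' * A2 = -A2 := by
        rw [← h2.idem_mul, ← Matrix.mul_assoc, eR' (-1) (by norm_num), neg_one_smul,
          Matrix.neg_mul]
      rw [Matrix.add_mul, Matrix.mul_add, f1, f2, f3, f4]
  obtain ⟨A0, B0, h0, hA0⟩ := h0
  -- The isomorphisms for negative `k` are transported by `R` and `R'` from those for positive `k`.
  have hAB : ∃ (A : ℤ → Matrix n m ℂ) (B : ℤ → Matrix m n ℂ),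
      (∀ k, IsIdemIso (P k) (P' k) (A k) (B k)) ∧ ∀ k, A k * R = R' * A (-k) := by
    have hneg : ∀ X : Matrix n m ℂ, R' * X * R * R = R' * X := fun X => by
      rw [Matrix.mul_assoc _ R R, hR, Matrix.mul_one]
    have hneg' : ∀ X : Matrix n m ℂ, R' * (R' * X * R) = X * R := fun X => by
      rw [← Matrix.mul_assoc, ← Matrix.mul_assoc, hR', Matrix.one_mul]
    refine ⟨fun k => if 0 < k then C k else if k = 0 then A0 else R' * C (-k) * R,
      fun k => if 0 < k then D k else if k = 0 then B0 else R * D (-k) * R', fun k => ?_,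
      fun k => ?_⟩
    · rcases lt_trichotomy k 0 with hk | rfl | hk
      · have := (hCD (-k)).conj hR hR'
        rw [hRP, hRP', neg_neg] at this
        simpa [hk.not_gt, hk.ne] using this
      · simpa using h0
      · simpa [hk] using hCD k
    · rcases lt_trichotomy k 0 with hk | rfl | hk
      · simp [hk.not_gt, hk.ne, hk, hneg]
      · simpa using hA0
      · have : -k ≠ 0 := by omega
        simp [hk, hk.le.not_gt, hk.ne', hneg']
  obtain ⟨A, B, hI, hA⟩ := hAB
  have o1 : ∀ k l, k ≠ l → A k * B l = 0 := fun k l hkl => by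
    rw [← (hI k).mul_idem, ← (hI l).idem_mul_inv, Matrix.mul_assoc, ← Matrix.mul_assoc (P k), hP,
      if_neg hkl]
    simp
  have o2 : ∀ k l, k ≠ l → B k * A l = 0 := fun k l hkl => by
    rw [← (hI k).inv_mul_idem, ← (hI l).idem_mul, Matrix.mul_assoc, ← Matrix.mul_assoc (P' k), hP',
      if_neg hkl]
    simp
  have o3 : ∀ k l, k ≠ l → A k * P l = 0 := fun k l hkl => by
    rw [← (hI k).mul_idem, Matrix.mul_assoc, hP, if_neg hkl, Matrix.mul_zero]
  have o4 : ∀ k l, k ≠ l → P' k * A l = 0 := fun k l hkl => by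
    rw [← (hI l).idem_mul, ← Matrix.mul_assoc, hP', if_neg hkl, Matrix.zero_mul]
  refine ⟨∑ k ∈ Finset.Icc (-(N : ℤ)) N, A k, ∑ k ∈ Finset.Icc (-(N : ℤ)) N, B k, ?_, ?_, ?_, ?_⟩
  · rw [Matrix.sum_mul, ← hN']
    refine Finset.sum_congr rfl fun k hk => ?_
    rw [Matrix.mul_sum, Finset.sum_eq_single_of_mem k hk fun l _ hl => o1 k l hl.symm, (hI k).mul_inv]
  · rw [Matrix.sum_mul, ← hN]
    refine Finset.sum_congr rfl fun k hk => ?_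
    rw [Matrix.mul_sum, Finset.sum_eq_single_of_mem k hk fun l _ hl => o2 k l hl.symm, (hI k).inv_mul]
  · rw [Matrix.sum_mul, Matrix.mul_sum]
    refine Finset.sum_nbij' (fun k => -k) (fun k => -k) ?_ ?_ ?_ ?_ fun k _ => hA k
    · intro k hk; rw [Finset.mem_Icc] at *; omega
    · intro k hk; rw [Finset.mem_Icc] at *; omega
    · simp
    · simp
  · intro k hk
    rw [Matrix.sum_mul, Matrix.mul_sum,
      Finset.sum_eq_single_of_mem k hk fun l _ hl => o3 l k hl,
      Finset.sum_eq_single_of_mem k hk fun l _ hl => o4 k l hl.symm, (hI k).mul_idem,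
      (hI k).idem_mul]

/-! ### Fourier analysis on `O(2)` -/

namespace O2

open MeasureTheory AddCircle

/-- Restriction of functions on `O(2)` to the rotations, parametrized by `ℝ/ℤ`. -/
def onRot : C(O2, ℂ) →ₐ[ℂ] C(UnitAddCircle, ℂ) :=
  ContinuousMap.compRightAlgHom ℂ ℂ
    ⟨fun θ => rot (toCircle θ), continuous_rot.comp continuous_toCircle⟩

lemma onRot_apply (f : C(O2, ℂ)) (θ : UnitAddCircle) : onRot f θ = f (rot (toCircle θ)) := rfl

lemma fourier_eq_zpow (k : ℤ) (θ : UnitAddCircle) : fourier k θ = (toCircle θ : ℂ) ^ k := by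
  rw [fourier_apply, toCircle_zsmul, Circle.coe_zpow]

lemma exists_toCircle (w : Circle) : ∃ θ : UnitAddCircle, toCircle θ = w := by
  obtain ⟨θ, h⟩ := (homeomorphCircle (T := 1) one_ne_zero).surjective w
  exact ⟨θ, by rw [← h, homeomorphCircle_apply]⟩

/-- The `k`-th Fourier coefficient of a continuous function, as a linear functional. -/
def circleCoeff (k : ℤ) : C(UnitAddCircle, ℂ) →ₗ[ℂ] ℂ where
  toFun f := fourierCoeff f k
  map_add' f g := by
    have hi : ∀ f : C(UnitAddCircle, ℂ), Integrable f haarAddCircle := fun f =>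
      f.continuous.integrable_of_hasCompactSupport (HasCompactSupport.of_compactSpace _)
    rw [ContinuousMap.coe_add, fourierCoeff.add (hi f) (hi g), Pi.add_apply]
  map_smul' c f := by
    rw [ContinuousMap.coe_smul, fourierCoeff.const_smul, RingHom.id_apply]

lemma circleCoeff_fourier (k l : ℤ) : circleCoeff k (fourier l) = if k = l then 1 else 0 := by
  change fourierCoeff (fourier l) k = _
  rw [fourierCoeff_fourier, Pi.single_apply]

lemma circleCoeff_translate (k : ℤ) {f f' : C(UnitAddCircle, ℂ)} (s : UnitAddCircle)
    (h : ∀ t, f' t = f (s + t)) : circleCoeff k f' = (toCircle s : ℂ) ^ k * circleCoeff k f := by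
  have e : ∀ t : UnitAddCircle, fourier (-k) t • f' t =
      (fun x => (toCircle s : ℂ) ^ k * (fourier (-k) x • f x)) (s + t) := by
    intro t
    have hs : (toCircle s : ℂ) ^ k ≠ 0 := zpow_ne_zero _ (Circle.coe_ne_zero _)
    simp only [h, fourier_eq_zpow, toCircle_add, Circle.coe_mul, mul_zpow, smul_eq_mul, zpow_neg]
    field_simp
  change ∫ t, fourier (-k) t • f' t ∂haarAddCircle =
    _ * ∫ t, fourier (-k) t • f t ∂haarAddCircle
  simp_rw [e]
  rw [integral_add_left_eq_self (fun x => (toCircle s : ℂ) ^ k * (fourier (-k) x • f x)) s,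
    integral_const_mul]

/-- The `k`-th Fourier coefficient of the restriction to the rotations. -/
def coeff (k : ℤ) : C(O2, ℂ) →ₗ[ℂ] ℂ := circleCoeff k ∘ₗ onRot.toLinearMap

lemma coeff_apply (k : ℤ) (f : C(O2, ℂ)) : coeff k f = circleCoeff k (onRot f) := rfl

lemma coeff_conjRefl (k : ℤ) (f : C(O2, ℂ)) : coeff k (conjRefl f) = coeff (-k) f := by
  have e : ∀ θ : UnitAddCircle, fourier (-k) θ • (onRot (conjRefl f)) θ =
      (fun θ => fourier k θ • (onRot f) θ) (-θ) := by
    intro θ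
    simp only [onRot_apply, conjRefl_rot, toCircle_neg, fourier_eq_zpow, Circle.coe_inv,
      inv_zpow', zpow_neg]
  change ∫ θ, fourier (-k) θ • (onRot (conjRefl f)) θ ∂haarAddCircle =
    ∫ θ, fourier (-(-k)) θ • (onRot f) θ ∂haarAddCircle
  simp_rw [e]
  rw [integral_neg_eq_self (fun θ => fourier k θ • (onRot f) θ), neg_neg]

/-- Right translation by `refl`. -/
def mulReflRight : C(O2, ℂ) →ₐ[ℂ] C(O2, ℂ) :=
  ContinuousMap.compRightAlgHom ℂ ℂ ⟨fun M : O2 => M * refl, by fun_prop⟩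

lemma mulReflRight_apply (f : C(O2, ℂ)) (M : O2) : mulReflRight f M = f (M * refl) := rfl

lemma mulReflRight_ind_mul_zpow (ε : Bool) (k : ℤ) :
    mulReflRight (ind ε * zpow k) = ind (!ε) * zpow k := by
  refine ext_rot (fun w => ?_) (fun w => ?_)
  · rw [mulReflRight_apply]
    cases ε <;> simp
  · rw [mulReflRight_apply, mul_assoc, refl_mul_refl, mul_one]
    cases ε <;> simp

lemma coeff_ind_mul_zpow (ε : Bool) (k l : ℤ) :
    coeff k (ind ε * zpow l) = if ε ∧ k = l then 1 else 0 := by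
  cases ε
  · have : onRot (ind false * zpow l) = 0 := by
      ext θ
      simp [onRot_apply]
    simp [coeff_apply, this]
  · have : onRot (ind true * zpow l) = fourier l := by
      ext θ
      simp [onRot_apply, toCircle_zsmul]
    simp [coeff_apply, this, circleCoeff_fourier]

lemma linearIndependent_ind_mul_zpow :
    LinearIndependent ℂ fun x : Bool × ℤ => ind x.1 * zpow x.2 := by
  refine LinearIndependent.of_pairwise_dual_eq_zero_one _
    (fun x => if x.1 then coeff x.2 else coeff x.2 ∘ₗ mulReflRight.toLinearMap) ?_ ?_
  · rintro ⟨ε, k⟩ ⟨ε', l⟩ h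
    cases ε <;> cases ε' <;> simp_all [mulReflRight_ind_mul_zpow, coeff_ind_mul_zpow, -map_mul]
  · rintro ⟨ε, k⟩
    cases ε <;> simp [mulReflRight_ind_mul_zpow, coeff_ind_mul_zpow, -map_mul]

end O2

/-! ### Representations of `O(2)` -/

open O2 AddCircle

section Isotypic

variable {n : ℕ}

/-- The value of a matrix of functions at a point. -/
def evalMat (u : Matrix (Fin n) (Fin n) C(O2, ℂ)) (M : O2) : Matrix (Fin n) (Fin n) ℂ :=
  u.map fun f => f M

/-- The matrix of the `k`-th Fourier coefficients on the rotations: for a representation `u`, the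
projection to the subspace on which the rotations act by their `k`-th power. -/
def isotypic (u : Matrix (Fin n) (Fin n) C(O2, ℂ)) (k : ℤ) : Matrix (Fin n) (Fin n) ℂ :=
  u.map (coeff k)

lemma trace_isotypic (u : Matrix (Fin n) (Fin n) C(O2, ℂ)) (k : ℤ) :
    (isotypic u k).trace = coeff k u.trace := by
  simp [isotypic, Matrix.trace]

end Isotypic

namespace IsGroupRep

variable {n : ℕ} {u : Matrix (Fin n) (Fin n) C(O2, ℂ)}

lemma evalMat_mul (hu : IsGroupRep O2 u) (g h : O2) :
    evalMat u (g * h) = evalMat u g * evalMat u h := hu.1 g h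

lemma evalMat_one (hu : IsGroupRep O2 u) : evalMat u 1 = 1 := hu.2

lemma evalMat_refl_mul_self (hu : IsGroupRep O2 u) : evalMat u refl * evalMat u refl = 1 := by
  rw [← hu.evalMat_mul, refl_mul_refl, hu.evalMat_one]

lemma apply_mul (hu : IsGroupRep O2 u) (g h : O2) (i j : Fin n) :
    u i j (g * h) = ∑ l, u i l g * u l j h := congrFun (congrFun (hu.evalMat_mul g h) i) j

lemma evalMat_rot_mul_isotypic (hu : IsGroupRep O2 u) (w : Circle) (k : ℤ) :
    evalMat u (rot w) * isotypic u k = (w : ℂ) ^ k • isotypic u k := by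
  obtain ⟨s, rfl⟩ := exists_toCircle w
  ext i j
  have h := circleCoeff_translate k (f := onRot (u i j))
    (f' := onRot (∑ l, u i l (rot (toCircle s)) • u l j)) s (fun t => by
      rw [onRot_apply, onRot_apply, toCircle_add, map_mul, hu.apply_mul]
      simp)
  rw [← coeff_apply, ← coeff_apply, map_sum] at h
  simpa [isotypic, evalMat, Matrix.mul_apply] using h

/-- The Fourier coefficients of a representation are orthogonal idempotents: since the rotations
act on the image of `isotypic u l` by their `l`-th power, this is the orthogonality of the
exponentials. -/
lemma isotypic_mul_isotypic (hu : IsGroupRep O2 u) (k l : ℤ) :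
    isotypic u k * isotypic u l = if k = l then isotypic u k else 0 := by
  ext i j
  have e : onRot (∑ m, isotypic u l m j • u i m) = isotypic u l i j • fourier l := by
    ext θ
    have h := congrFun (congrFun (hu.evalMat_rot_mul_isotypic (toCircle θ) l) i) j
    rw [Matrix.mul_apply, Matrix.smul_apply] at h
    simp only [onRot_apply, ContinuousMap.sum_apply, ContinuousMap.smul_apply, smul_eq_mul,
      fourier_eq_zpow]
    rw [mul_comm, ← smul_eq_mul, ← h]
    exact Finset.sum_congr rfl fun m _ => mul_comm _ _
  have h : coeff k (∑ m, isotypic u l m j • u i m) = (isotypic u k * isotypic u l) i j := by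
    simp [isotypic, Matrix.mul_apply, mul_comm]
  rw [← h, coeff_apply, e, map_smul, circleCoeff_fourier]
  split_ifs with hkl <;> simp [hkl]

lemma refl_conj_isotypic (hu : IsGroupRep O2 u) (k : ℤ) :
    evalMat u refl * isotypic u k * evalMat u refl = isotypic u (-k) := by
  ext i j
  have e : conjRefl (u i j) = ∑ l, ∑ m, (u i m refl * u l j refl) • u m l := by
    ext M
    rw [conjRefl_apply, hu.apply_mul]
    simp only [hu.apply_mul refl M, ContinuousMap.sum_apply, ContinuousMap.smul_apply, smul_eq_mul,
      Finset.sum_mul]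
    exact Finset.sum_congr rfl fun l _ => Finset.sum_congr rfl fun m _ => by ring
  have h := coeff_conjRefl k (u i j)
  rw [e] at h
  simp only [isotypic, evalMat, Matrix.map_apply, Matrix.mul_apply, ← h, map_sum, map_smul,
    smul_eq_mul, Finset.sum_mul]
  exact Finset.sum_congr rfl fun l _ => Finset.sum_congr rfl fun m _ => by ring

lemma trace_isotypic_mul_refl (hu : IsGroupRep O2 u) (k : ℤ) :
    (isotypic u k * evalMat u refl).trace = coeff k (mulReflRight u.trace) := by
  have e : ∀ i, mulReflRight (u i i) = ∑ l, u l i refl • u i l := by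
    intro i
    ext M
    rw [mulReflRight_apply, hu.apply_mul]
    simp [mul_comm]
  simp [Matrix.trace, e, Matrix.mul_apply, isotypic, evalMat, mul_comm]

/-- Only finitely many characters of the rotation group occur in a representation, since the
projections to the isotypic components are linearly independent. -/
lemma finite_isotypic_ne_zero (hu : IsGroupRep O2 u) : {k | isotypic u k ≠ 0}.Finite := by
  have h : LinearIndependent ℂ fun k : {k | isotypic u k ≠ 0} => isotypic u k := by
    rw [linearIndependent_iff']
    intro s c hs k hk
    have h1 := congrArg (isotypic u k * ·) hs
    simp only [Finset.mul_sum, Matrix.mul_smul, hu.isotypic_mul_isotypic, mul_zero] at h1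
    rw [Finset.sum_eq_single_of_mem k hk fun l _ hl => by
      rw [if_neg fun h => hl (Subtype.ext h.symm), smul_zero], if_pos rfl] at h1
    exact (smul_eq_zero.1 h1).resolve_right k.2
  exact Set.finite_coe_iff.1 h.finite_of_isNoetherian

/-- On the rotations, a representation is a trigonometric polynomial. -/
lemma exists_evalMat_rot (hu : IsGroupRep O2 u) : ∃ N₀ : ℕ, ∀ N : ℕ, N₀ ≤ N → ∀ w : Circle,
    evalMat u (rot w) = ∑ k ∈ Finset.Icc (-(N : ℤ)) N, (w : ℂ) ^ k • isotypic u k := by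
  obtain ⟨N₀, hN₀⟩ : ∃ N₀ : ℕ, ∀ k, isotypic u k ≠ 0 → k.natAbs ≤ N₀ := by
    obtain ⟨N₀, h⟩ := (hu.finite_isotypic_ne_zero.image Int.natAbs).bddAbove
    exact ⟨N₀, fun k hk => h ⟨k, hk, rfl⟩⟩
  refine ⟨N₀, fun N hN w => ?_⟩
  have h0 : ∀ k ∉ Finset.Icc (-(N : ℤ)) N, isotypic u k = 0 := by
    intro k hk
    by_contra h
    have := hN₀ k h
    rw [Finset.mem_Icc] at hk
    omega
  obtain ⟨θ, rfl⟩ := exists_toCircle w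
  ext i j
  have h1 : ∀ k ∉ Finset.Icc (-(N : ℤ)) N, fourierCoeff (onRot (u i j)) k = 0 := fun k hk =>
    congrFun (congrFun (h0 k hk) i) j
  have h2 := has_pointwise_sum_fourier_series_of_summable
    (summable_of_ne_finset_zero (s := Finset.Icc (-(N : ℤ)) N) h1) θ
  have h3 : HasSum (fun k => fourierCoeff (onRot (u i j)) k • fourier k θ)
      (∑ k ∈ Finset.Icc (-(N : ℤ)) N, fourierCoeff (onRot (u i j)) k • fourier k θ) :=
    hasSum_sum_of_ne_finset_zero fun k hk => by simp [h1 k hk]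
  rw [Matrix.sum_apply]
  refine (h2.unique h3).trans (Finset.sum_congr rfl fun k _ => ?_)
  rw [fourier_eq_zpow, smul_eq_mul, mul_comm]
  rfl

/-- Representations of `O(2)` with the same character are equivalent. -/
theorem matEquiv_of_trace_eq {m : ℕ} {v : Matrix (Fin m) (Fin m) C(O2, ℂ)}
    (hu : IsGroupRep O2 u) (hv : IsGroupRep O2 v) (h : u.trace = v.trace) : MatEquiv u v := by
  obtain ⟨N₁, h1⟩ := hu.exists_evalMat_rot
  obtain ⟨N₂, h2⟩ := hv.exists_evalMat_rot
  have e1 := h1 _ (le_max_left N₁ N₂)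
  have e2 := h2 _ (le_max_right N₁ N₂)
  obtain ⟨T, S, hTS, hST, hR, hP⟩ := exists_intertwiner hu.isotypic_mul_isotypic
    hv.isotypic_mul_isotypic hu.evalMat_refl_mul_self hv.evalMat_refl_mul_self
    hu.refl_conj_isotypic hv.refl_conj_isotypic
    (fun k => by rw [trace_isotypic, trace_isotypic, h])
    (by rw [hu.trace_isotypic_mul_refl, hv.trace_isotypic_mul_refl, h]) (N := max N₁ N₂)
    (by simpa [hu.evalMat_one] using (e1 1).symm) (by simpa [hv.evalMat_one] using (e2 1).symm)
  have hrot : ∀ w, T * evalMat u (rot w) = evalMat v (rot w) * T := by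
    intro w
    rw [e1, e2, Matrix.mul_sum, Matrix.sum_mul]
    refine Finset.sum_congr rfl fun k hk => ?_
    rw [Matrix.mul_smul, Matrix.smul_mul, hP k hk]
  have hall : ∀ M, T * evalMat u M = evalMat v M * T := by
    intro M
    obtain ⟨w, rfl | rfl⟩ := exists_rot M
    · exact hrot w
    · rw [hu.evalMat_mul, hv.evalMat_mul, ← Matrix.mul_assoc, hrot, Matrix.mul_assoc, hR,
        Matrix.mul_assoc]
  refine ⟨T, S, hTS, hST, ?_⟩
  ext i j M
  have := congrFun (congrFun (hall M) i) j
  simpa [scal, Matrix.mul_apply, evalMat] using this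

/-- The matrix entries of a representation of `O(2)` are trigonometric polynomials. -/
lemma mem_span (hu : IsGroupRep O2 u) (i j : Fin n) :
    u i j ∈ Submodule.span ℂ (Set.range fun x : Bool × ℤ => ind x.1 * zpow x.2) := by
  obtain ⟨N, hN⟩ := hu.exists_evalMat_rot
  have e : u i j = ∑ k ∈ Finset.Icc (-(N : ℤ)) N, (isotypic u k i j • (ind true * zpow k) +
      (isotypic u k * evalMat u refl) i j • (ind false * zpow k)) := by
    refine ext_rot (fun w => ?_) (fun w => ?_)
    · have := congrFun (congrFun (hN N le_rfl w) i) j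
      rw [Matrix.sum_apply] at this
      refine this.trans ?_
      simp [mul_comm]
    · have := hu.evalMat_mul (rot w) refl
      rw [hN N le_rfl w, Matrix.sum_mul] at this
      have := congrFun (congrFun this i) j
      rw [Matrix.sum_apply] at this
      refine this.trans ?_
      simp [mul_comm]
  rw [e]
  exact Submodule.sum_mem _ fun k _ => Submodule.add_mem _
    (Submodule.smul_mem _ _ (Submodule.subset_span ⟨(true, k), rfl⟩))
    (Submodule.smul_mem _ _ (Submodule.subset_span ⟨(false, k), rfl⟩))

/-- Characters are invariant under conjugation. -/
lemma conjRefl_trace (hu : IsGroupRep O2 u) : conjRefl u.trace = u.trace := by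
  ext M
  have h : ∀ M, u.trace M = (evalMat u M).trace := fun M => by
    simp [Matrix.trace, evalMat]
  rw [conjRefl_apply, h, h, hu.evalMat_mul, hu.evalMat_mul, Matrix.trace_mul_comm,
    ← Matrix.mul_assoc, hu.evalMat_refl_mul_self, Matrix.one_mul]

end IsGroupRep

/-! ### Corepresentations of `𝒜₂(ℤ/2)` and representations of `O(2)` -/

namespace WreathAlg

open O2

variable {G : Type*} [Group G] {γ : G} (hγ : γ ≠ 1) (hG : ∀ g : G, g = 1 ∨ g = γ)

lemma toO2_injective : Function.Injective (toO2 hγ hG) := by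
  refine (injective_iff_map_eq_zero _).2 fun x hx => ?_
  have hs : x ∈ Submodule.span ℂ (Set.range fun x : Bool × ℤ => idem G x.1 * word γ x.2) := by
    rw [span_idem_mul_word (mul_self_eq_one hγ hG) hG]
    trivial
  obtain ⟨c, rfl⟩ := Finsupp.mem_span_range_iff_exists_finsupp.1 hs
  have h0 : Finsupp.linearCombination ℂ (fun x : Bool × ℤ => ind x.1 * zpow x.2) c = 0 := by
    rw [← hx, Finsupp.linearCombination_apply, map_finsuppSum]
    simp [toO2_idem_mul_word]
  rw [linearIndependent_iff.1 linearIndependent_ind_mul_zpow c h0, Finsupp.sum_zero_index]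

lemma mem_range_toO2 {n : ℕ} {u : Matrix (Fin n) (Fin n) C(O2, ℂ)} (hu : IsGroupRep O2 u)
    (i j : Fin n) : ∃ x, toO2 hγ hG x = u i j := by
  have h : Submodule.span ℂ (Set.range fun x : Bool × ℤ => ind x.1 * zpow x.2) ≤
      LinearMap.range (toO2 hγ hG) := by
    refine Submodule.span_le.2 ?_
    rintro _ ⟨⟨ε, k⟩, rfl⟩
    exact ⟨_, toO2_idem_mul_word hγ hG ε k⟩
  exact h (hu.mem_span i j)

/-- Evaluations at pairs of points of `O(2)` separate the points of `𝒜₂(ℤ/2) ⊗ 𝒜₂(ℤ/2)`. -/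
lemma eq_zero_of_evalTensor {X : WreathAlg 2 G ⊗[ℂ] WreathAlg 2 G}
    (hX : ∀ g h, evalTensor hγ hG g h X = 0) : X = 0 := by
  let b := Module.Basis.ofVectorSpace ℂ (WreathAlg 2 G)
  obtain ⟨c, rfl⟩ := TensorProduct.eq_repr_basis_right b X
  -- Evaluating the second factor at all points shows that evaluating only the first one gives `0`.
  have h1 : ∀ g, c.sum (fun i x => toO2 hγ hG x g • b i) = 0 := by
    intro g
    refine toO2_injective hγ hG ?_
    rw [map_zero]
    ext h
    have := hX g h
    rw [map_finsuppSum] at this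
    simpa [Finsupp.sum, evalTensor_tmul] using this
  have h2 : ∀ i, c i = 0 := by
    intro i
    refine toO2_injective hγ hG ?_
    rw [map_zero]
    ext g
    by_cases hi : i ∈ c.support
    · exact linearIndependent_iff'.1 b.linearIndependent c.support
        (fun i => toO2 hγ hG (c i) g) (h1 g) i hi
    · simp [Finsupp.notMem_support_iff.1 hi]
  rw [Finsupp.ext h2 (g := 0), Finsupp.sum_zero_index]

/-- A matrix over `𝒜₂(ℤ/2)` is a corepresentation if and only if the corresponding matrix of
functions is a representation of `O(2)`. -/
lemma isCorep_iff {n : ℕ} {u : Matrix (Fin n) (Fin n) (WreathAlg 2 G)} :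
    IsCorep (WreathAlg 2 G) u ↔ IsGroupRep O2 (u.map (toO2 hγ hG)) := by
  have e : ∀ g h i j, evalTensor hγ hG g h (∑ k, u i k ⊗ₜ[ℂ] u k j) =
      ∑ k, toO2 hγ hG (u i k) g * toO2 hγ hG (u k j) h := by
    intro g h i j
    rw [map_sum]
    simp [evalTensor_tmul]
  constructor
  · intro hu
    refine ⟨fun g h => ?_, ?_⟩
    · ext i j
      have h1 : comulHom (u i j) = ∑ k, u i k ⊗ₜ[ℂ] u k j := hu.1 i j
      simp [Matrix.mul_apply, toO2_apply_mul, h1, e]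
    · ext i j
      have h1 : counitHom (u i j) = if i = j then 1 else 0 := hu.2 i j
      simp [toO2_apply_one, h1, Matrix.one_apply]
  · intro hu
    refine ⟨fun i j => ?_, fun i j => ?_⟩
    · refine sub_eq_zero.1 (eq_zero_of_evalTensor hγ hG fun g h => ?_)
      have h1 := hu.apply_mul g h i j
      simp only [Matrix.map_apply, toO2_apply_mul] at h1
      rw [map_sub, e, sub_eq_zero]
      exact h1
    · have h1 := congrFun (congrFun hu.2 i) j
      simp only [Matrix.map_apply, toO2_apply_one, Matrix.one_apply] at h1
      exact h1

lemma map_toO2_scal_mul {m n p : ℕ} (T : Matrix (Fin m) (Fin n) ℂ)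
    (u : Matrix (Fin n) (Fin p) (WreathAlg 2 G)) :
    (scal (WreathAlg 2 G) T * u).map (toO2 hγ hG) = scal C(O2, ℂ) T * u.map (toO2 hγ hG) := by
  ext1 i j
  simp [scal, Matrix.mul_apply, ← Algebra.smul_def]

lemma map_toO2_mul_scal {m n p : ℕ} (T : Matrix (Fin n) (Fin p) ℂ)
    (u : Matrix (Fin m) (Fin n) (WreathAlg 2 G)) :
    (u * scal (WreathAlg 2 G) T).map (toO2 hγ hG) = u.map (toO2 hγ hG) * scal C(O2, ℂ) T := by
  ext1 i j
  simp [scal, Matrix.mul_apply, ← Algebra.commutes, ← Algebra.smul_def]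

lemma matEquiv_map_toO2_iff {m n : ℕ} {u : Matrix (Fin m) (Fin m) (WreathAlg 2 G)}
    {v : Matrix (Fin n) (Fin n) (WreathAlg 2 G)} :
    MatEquiv (u.map (toO2 hγ hG)) (v.map (toO2 hγ hG)) ↔ MatEquiv u v := by
  constructor
  · rintro ⟨T, S, h1, h2, h3⟩
    rw [← map_toO2_scal_mul, ← map_toO2_mul_scal] at h3
    exact ⟨T, S, h1, h2, Matrix.map_injective (toO2_injective hγ hG) h3⟩
  · rintro ⟨T, S, h1, h2, h3⟩
    refine ⟨T, S, h1, h2, ?_⟩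
    rw [← map_toO2_scal_mul, ← map_toO2_mul_scal, h3]

lemma trace_map_toO2 {n : ℕ} (u : Matrix (Fin n) (Fin n) (WreathAlg 2 G)) :
    (u.map (toO2 hγ hG)).trace = toO2 hγ hG u.trace := by
  simp [Matrix.trace]

/-- The representation of `O(2)` that corresponds to a corepresentation of `𝒜₂(ℤ/2)`. -/
def repO2 (u : (corepClass (WreathAlg 2 G)).Rep) : (groupRepClass O2).Rep :=
  ⟨u.dim, u.mat.map (toO2 hγ hG), (isCorep_iff hγ hG).1 u.isRep⟩

lemma repO2_add (u v : (corepClass (WreathAlg 2 G)).Rep) :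
    repO2 hγ hG (u.add v) = (repO2 hγ hG u).add (repO2 hγ hG v) := by
  have h : (u.add v).mat.map (toO2 hγ hG) = ((repO2 hγ hG u).add (repO2 hγ hG v)).mat := by
    ext1 i j
    obtain ⟨i, rfl⟩ := finSumFinEquiv.surjective i
    obtain ⟨j, rfl⟩ := finSumFinEquiv.surjective j
    rcases i with i | i <;> rcases j with j | j <;>
      simp [RepClass.Rep.add, repO2, dsum, -finSumFinEquiv_apply_left, -finSumFinEquiv_apply_right]
  have ext : ∀ {d : ℕ} {A B : Matrix (Fin d) (Fin d) C(O2, ℂ)} (hA : IsGroupRep O2 A)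
      (hB : IsGroupRep O2 B), A = B →
        (⟨d, A, hA⟩ : (groupRepClass O2).Rep) = ⟨d, B, hB⟩ := by
    rintro d A _ hA hB rfl
    rfl
  exact ext _ _ h

/-- Tensor products are preserved up to equivalence, because the characters are multiplied. -/
lemma repO2_mul (u v : (corepClass (WreathAlg 2 G)).Rep) :
    MatEquiv (repO2 hγ hG (u.mul v)).mat ((repO2 hγ hG u).mul (repO2 hγ hG v)).mat := by
  refine IsGroupRep.matEquiv_of_trace_eq (repO2 hγ hG (u.mul v)).isRep
    ((repO2 hγ hG u).mul (repO2 hγ hG v)).isRep ?_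
  have hv : conjRefl (toO2 hγ hG v.mat.trace) = toO2 hγ hG v.mat.trace := by
    rw [← trace_map_toO2]
    exact IsGroupRep.conjRefl_trace (repO2 hγ hG v).isRep
  have h1 : (repO2 hγ hG (u.mul v)).mat.trace = toO2 hγ hG (u.mat.trace * v.mat.trace) := by
    rw [← trace_tens, ← (u.mul_equiv v).trace_eq]
    exact trace_map_toO2 hγ hG _
  rw [h1, toO2_mul hγ hG _ _ hv, (RepClass.Rep.mul_equiv _ _).trace_eq, trace_tens,
    ← trace_map_toO2, ← trace_map_toO2]
  rfl

/-- The isomorphism of fusion semirings induced by the isomorphism of coalgebras `toO2`. -/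
def fusionEquiv : FusionSemiring (WreathAlg 2 G) ≃+* GroupFusionSemiring O2 where
  toEquiv := Equiv.ofBijective
    (Quotient.map (repO2 hγ hG) fun _ _ h => (matEquiv_map_toO2_iff hγ hG).2 h) <| by
    constructor
    · rintro ⟨u⟩ ⟨v⟩ h
      exact Quotient.sound ((matEquiv_map_toO2_iff hγ hG).1 (Quotient.exact h))
    · rintro ⟨⟨n, u, hu⟩⟩
      choose x hx using mem_range_toO2 hγ hG hu
      have e : (Matrix.of x).map (toO2 hγ hG) = u := by
        ext1 i j
        exact hx i j
      refine ⟨Quotient.mk _ ⟨n, Matrix.of x, (isCorep_iff hγ hG).2 (e ▸ hu)⟩, ?_⟩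
      refine Quotient.sound (?_ : MatEquiv _ _)
      change MatEquiv ((Matrix.of x).map (toO2 hγ hG)) u
      rw [e]
      exact .refl u
  map_add' := by
    rintro ⟨u⟩ ⟨v⟩
    exact congrArg _ (repO2_add hγ hG u v)
  map_mul' := by
    rintro ⟨u⟩ ⟨v⟩
    exact Quotient.sound (repO2_mul hγ hG u v)

end WreathAlg

lemma GroupFusionSemiring.mul_comm {K : Type*} [Group K] [TopologicalSpace K]
    (x y : GroupFusionSemiring K) : x * y = y * x := by
  obtain ⟨u⟩ := x
  obtain ⟨v⟩ := y
  refine Quotient.sound (?_ : MatEquiv _ _)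
  exact ((RepClass.Rep.mul_equiv u v).trans (.of_equiv (Equiv.prodComm _ _)
    fun i j => _root_.mul_comm _ _)).trans (RepClass.Rep.mul_equiv v u).symm

end Fusion

end

theorem corollary2p7 {G : Type*} [Group G] [Nontrivial G] :
    ((∀ x y : Fusion.FusionSemiring (Fusion.WreathAlg 2 G), x * y = y * x) ↔
      Nonempty (G ≃* Multiplicative (ZMod 2))) ∧
    (Nonempty (G ≃* Multiplicative (ZMod 2)) →
      Nonempty (Fusion.FusionSemiring (Fusion.WreathAlg 2 G) ≃+*
        Fusion.GroupFusionSemiring (Matrix.orthogonalGroup (Fin 2) ℝ))) := by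
  have iso : Nonempty (G ≃* Multiplicative (ZMod 2)) →
      Nonempty (Fusion.FusionSemiring (Fusion.WreathAlg 2 G) ≃+*
        Fusion.GroupFusionSemiring (Matrix.orthogonalGroup (Fin 2) ℝ)) := by
    rintro ⟨e⟩
    obtain ⟨γ, hγ⟩ := exists_ne (1 : G)
    have hZ : ∀ a b : Multiplicative (ZMod 2), a ≠ 1 → b = 1 ∨ b = a := by decide
    have hG : ∀ g : G, g = 1 ∨ g = γ := by
      intro g
      have := hZ (e γ) (e g) (by simpa using hγ)
      simpa using this
    exact ⟨Fusion.WreathAlg.fusionEquiv hγ hG⟩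
  refine ⟨⟨fun H => ?_, fun h x y => ?_⟩, iso⟩
  · obtain ⟨γ, hγ⟩ := exists_ne (1 : G)
    have hG : ∀ g : G, g = 1 ∨ g = γ := fun g =>
      or_iff_not_imp_left.2 fun hg => Fusion.WreathAlg.eq_of_commutative H hg hγ
    have hcard : Nat.card G = 2 := by
      rw [Nat.card_eq_two_iff]
      exact ⟨1, γ, hγ.symm, Set.eq_univ_of_forall fun g => by simpa using hG g⟩
    exact ⟨mulEquivOfPrimeCardEq (p := 2) hcard (by simp)⟩
  · obtain ⟨f⟩ := iso h
    refine f.injective ?_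
    rw [map_mul, map_mul, Fusion.GroupFusionSemiring.mul_comm]
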